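/- For $n\in\{1,2\}$ and a finite set $K$ let $\mathcal G_n(K)$ be the space of isomorphism classes of connected, locally finite simple graphs with $n$ distinguished vertices (roots) and a mark in $K$ at every vertex, with the Borel $\sigma$-algebra of local convergence (generated by the isomorphism types of the finite balls around the roots). A unimodular random (marked) graph is a probability measure $\mu$ on $\mathcal G_1(K)$ satisfying the mass transport principle $$\int \sum_{x\in V(G)} f(G,o,x)\,d\mu(G,o)=\int \sum_{x\in V(G)} f(G,x,o)\,d\mu(G,o)$$ for every Borel function $f:\mathcal G_2(K)\to[0,\infty]$; without marks, take $K$ to be a single point. A random coloring $(c(v))_{v\in V(G)}$ of a graph $G$ is $2$-dependent if $(c(v))_{v\in A}$ and $(c(v))_{v\in B}$ are independent for all $A,B\subset V(G)$ at distance greater than $2$. Let $d\ge 0$ be an integer and $q=3^{d(d+1)/2}$. (1) Let $(G,o)$ be a unimodular random graph whose degrees are almost surely all at most $d$. Then there is a random proper coloring $c$ of the vertices of $G$ with $q$ colors such that the colored graph $(G,c,o)$ is a unimodular random marked graph and such that, almost surely, $c$ is $2$-dependent conditionally on $G$. (The conditional law of $c$ given $(G,o)$ is a family of laws $P_{(G,o)}$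 on $\{1,\dots,q\}^{V(G)}$ which is mapped to itself by isomorphisms of rooted graphs, and from which $(G,c,o)$ arises by choosing first $(G,o)$ and then $c$ with law $P_{(G,o)}$.) (2) In particular, let $G$ be a countable graph with all degrees at most $d$ which is transitive and unimodular, i.e. $\mathrm{Aut}(G)$ acts transitively on $V(G)$, and $|\mathrm{Stab}(x)\,y|=|\mathrm{Stab}(y)\,x|$ for all $x,y\in V(G)$, where $\mathrm{Stab}(x)$ is the stabilizer of $x$ in $\mathrm{Aut}(G)$. Then there is a random proper coloring of the vertices of $G$ with $q$ colors that is $2$-dependent and whose law is invariant under $\mathrm{Aut}(G)$. -/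

import Mathlib

open MeasureTheory ProbabilityTheory
open scoped ENNReal

/-- A connected, locally finite (simple) graph, with `n` distinguished vertices (roots) and a mark
in `K` at every vertex.  Such a graph is countable, so `V : Type` is no restriction.  We use
`n = 1` (rooted graphs) and `n = 2` (doubly rooted graphs); unmarked graphs are those with
`K = Unit`. -/
structure RootedGraph (K : Type) (n : ℕ) : Type 1 where
  V : Type
  graph : SimpleGraph V
  connected : graph.Connected
  locallyFinite : ∀ v, (graph.neighborSet v).Finite
  root : Fin n → V
  mark : V → K

namespace RootedGraph

variable {K : Type} {n : ℕ}

/-- The graph isomorphism `φ` respects the roots (in order) and the marks. -/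
structure IsRootedIso (Γ Γ' : RootedGraph K n) (φ : Γ.graph ≃g Γ'.graph) : Prop where
  root : ∀ i, φ (Γ.root i) = Γ'.root i
  mark : ∀ v, Γ'.mark (φ v) = Γ.mark v

/-- Isomorphism of rooted marked graphs, as an equivalence relation. -/
instance isoSetoid (K : Type) (n : ℕ) : Setoid (RootedGraph K n) where
  r Γ Γ' := ∃ φ, IsRootedIso Γ Γ' φ
  iseqv :=
    { refl := fun Γ => ⟨SimpleGraph.Iso.refl, ⟨fun _ => rfl, fun _ => rfl⟩⟩
      symm := by
        rintro Γ Γ' ⟨φ, h⟩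
        refine ⟨φ.symm, ⟨fun i => ?_, fun v => ?_⟩⟩
        · rw [← h.root i]; exact φ.symm_apply_apply _
        · rw [← h.mark (φ.symm v)]; exact congrArg Γ'.mark (φ.apply_symm_apply v)
      trans := by
        rintro Γ Γ' Γ'' ⟨φ, h⟩ ⟨ψ, k⟩
        refine ⟨φ.trans ψ, ⟨fun i => ?_, fun v => ?_⟩⟩
        · rw [← k.root i, ← h.root i]; rfl
        · rw [← h.mark v, ← k.mark (φ v)]; rfl }

/-- The vertices at graph distance at most `r` from (one of) the root(s). -/
def ball (Γ : RootedGraph K n) (r : ℕ) : Set Γ.V :=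
  {v | ∃ i, Γ.graph.dist (Γ.root i) v ≤ r}

/-- The balls of radius `r` around the roots are isomorphic as rooted marked graphs. -/
def BallIso (r : ℕ) (Γ Γ' : RootedGraph K n) : Prop :=
  ∃ φ : Γ.graph.induce (Γ.ball r) ≃g Γ'.graph.induce (Γ'.ball r),
    (∀ i (h : Γ.root i ∈ Γ.ball r), (φ ⟨Γ.root i, h⟩ : Γ'.V) = Γ'.root i) ∧
    ∀ v, Γ'.mark (φ v) = Γ.mark v

/-- Replace the marks. -/
def setMark {C : Type} (Γ : RootedGraph K n) (c : Γ.V → C) : RootedGraph C n where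
  V := Γ.V
  graph := Γ.graph
  connected := Γ.connected
  locallyFinite := Γ.locallyFinite
  root := Γ.root
  mark := c

/-- Replace the roots. -/
def setRoots {m : ℕ} (Γ : RootedGraph K n) (ρ : Fin m → Γ.V) : RootedGraph K m where
  V := Γ.V
  graph := Γ.graph
  connected := Γ.connected
  locallyFinite := Γ.locallyFinite
  root := ρ
  mark := Γ.mark

end RootedGraph

/-- The space of isomorphism classes of connected, locally finite graphs with `n` roots and with
marks in `K`. -/
def RootedGraphClass (K : Type) (n : ℕ) : Type 1 := Quotient (RootedGraph.isoSetoid K n)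

namespace RootedGraphClass

variable {K : Type} {n : ℕ}

/-- The isomorphism class of a rooted marked graph. -/
def mk (Γ : RootedGraph K n) : RootedGraphClass K n := Quotient.mk _ Γ

/-- A representative of an isomorphism class. -/
noncomputable def out (g : RootedGraphClass K n) : RootedGraph K n := Quotient.out g

/-- The Borel σ-algebra of the topology of local convergence.  For countable `K`, the only case
used, there are only countably many different sets "the ball of radius `r` around the roots is
isomorphic to that of `Γ`", and these form a base of the topology. -/
instance (K : Type) (n : ℕ) : MeasurableSpace (RootedGraphClass K n) :=
  MeasurableSpace.generateFrom
    {B | ∃ (r : ℕ) (Γ : RootedGraph K n), B = {g | ∃ Γ', mk Γ' = g ∧ Γ.BallIso r Γ'}}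

/-- The class of the underlying rooted graph, without its marks. -/
def forget : RootedGraphClass K n → RootedGraphClass Unit n :=
  Quotient.lift (fun Γ => mk (Γ.setMark fun _ => ())) (by
    rintro Γ Γ' ⟨φ, h⟩
    exact Quotient.sound ⟨φ, ⟨h.root, fun _ => rfl⟩⟩)

/-- All the degrees are at most `d`. -/
def DegreeLE (d : ℕ) (g : RootedGraphClass K n) : Prop :=
  ∀ Γ, mk Γ = g → ∀ v, (Γ.graph.neighborSet v).encard ≤ d

/-- The marks are a proper coloring of the vertices. -/
def IsProper (g : RootedGraphClass K n) : Prop :=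
  ∀ Γ, mk Γ = g → ∀ v w, Γ.graph.Adj v w → Γ.mark v ≠ Γ.mark w

/-- The total mass `∑ₓ f(G, o, x)` sent from the root `o`. -/
noncomputable def massOut (f : RootedGraphClass K 2 → ℝ≥0∞) : RootedGraphClass K 1 → ℝ≥0∞ :=
  Quotient.lift (fun Γ => ∑' x : Γ.V, f (mk (Γ.setRoots ![Γ.root 0, x]))) (by
    rintro Γ Γ' ⟨φ, h⟩
    show (∑' x : Γ.V, f (mk (Γ.setRoots ![Γ.root 0, x])))
      = ∑' x : Γ'.V, f (mk (Γ'.setRoots ![Γ'.root 0, x]))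
    rw [← φ.toEquiv.tsum_eq]
    refine tsum_congr fun x => congrArg f (Quotient.sound ⟨φ, ⟨fun i => ?_, h.mark⟩⟩)
    fin_cases i
    · exact h.root 0
    · rfl)

/-- The total mass `∑ₓ f(G, x, o)` received by the root `o`. -/
noncomputable def massIn (f : RootedGraphClass K 2 → ℝ≥0∞) : RootedGraphClass K 1 → ℝ≥0∞ :=
  Quotient.lift (fun Γ => ∑' x : Γ.V, f (mk (Γ.setRoots ![x, Γ.root 0]))) (by
    rintro Γ Γ' ⟨φ, h⟩
    show (∑' x : Γ.V, f (mk (Γ.setRoots ![x, Γ.root 0])))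
      = ∑' x : Γ'.V, f (mk (Γ'.setRoots ![x, Γ'.root 0]))
    rw [← φ.toEquiv.tsum_eq]
    refine tsum_congr fun x => congrArg f (Quotient.sound ⟨φ, ⟨fun i => ?_, h.mark⟩⟩)
    fin_cases i
    · rfl
    · exact h.root 0)

end RootedGraphClass

/-- A unimodular random rooted (marked) graph: a probability measure on the isomorphism classes of
rooted (marked) graphs that satisfies the mass transport principle. -/
structure IsUnimodular {K : Type} (μ : Measure (RootedGraphClass K 1)) : Prop where
  prob : IsProbabilityMeasure μ
  massTransport : ∀ f : RootedGraphClass K 2 → ℝ≥0∞, Measurable f →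
    ∫⁻ g, RootedGraphClass.massOut f g ∂μ = ∫⁻ g, RootedGraphClass.massIn f g ∂μ

/-- The law `P` of a random marking of the vertices of `G` is `k`-dependent: its restrictions to
any two sets of vertices at distance greater than `k` are independent. -/
def IsDependent {V C : Type*} [MeasurableSpace C] (G : SimpleGraph V) (k : ℕ)
    (P : Measure (V → C)) : Prop :=
  ∀ A B : Set V, (∀ a ∈ A, ∀ b ∈ B, (k : ℕ∞) < G.edist a b) →
    IndepFun (fun (c : V → C) (a : A) => c a) (fun (c : V → C) (b : B) => c b) P

/-- `P` is the conditional law of the marks given the underlying graph, for the random marked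
rooted graph with law `ν`, whose underlying unmarked rooted graph has law `μ`:
to every rooted graph, `P` assigns a law of a marking of its vertices, isomorphic rooted graphs get
corresponding laws, and `ν` arises by choosing the underlying rooted graph according to `μ`, then
its marks according to `P`. -/
structure IsConditionalLaw {C : Type} [MeasurableSpace C]
    (μ : Measure (RootedGraphClass Unit 1)) (ν : Measure (RootedGraphClass C 1))
    (P : (Γ : RootedGraph Unit 1) → Measure (Γ.V → C)) : Prop where
  prob : ∀ Γ, IsProbabilityMeasure (P Γ)
  equivariant : ∀ (Γ Γ' : RootedGraph Unit 1) (φ : Γ.graph ≃g Γ'.graph),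
    RootedGraph.IsRootedIso Γ Γ' φ → (P Γ).map (fun c v => c (φ.symm v)) = P Γ'
  measurable : ∀ B : Set (RootedGraphClass C 1), MeasurableSet B →
    Measurable fun g : RootedGraphClass Unit 1 =>
      P g.out {c | RootedGraphClass.mk (g.out.setMark c) ∈ B}
  disintegration : ∀ B : Set (RootedGraphClass C 1), MeasurableSet B →
    ν B = ∫⁻ g, P g.out {c | RootedGraphClass.mk (g.out.setMark c) ∈ B} ∂μ

/-- The automorphism group of `G` acts transitively on the vertices. -/
def IsTransitiveGraph {V : Type*} (G : SimpleGraph V) : Prop :=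
  ∀ x y, ∃ φ : G ≃g G, φ x = y

/-- The orbit of `y` under the stabilizer of `x` in the automorphism group of `G`. -/
def stabilizerOrbit {V : Type*} (G : SimpleGraph V) (x y : V) : Set V :=
  {z | ∃ φ : G ≃g G, φ x = x ∧ φ y = z}

/-- Unimodular transitive graphs: `|Stab(x) y| = |Stab(y) x|` for all vertices `x`, `y`. -/
structure IsUnimodularTransitive {V : Type*} (G : SimpleGraph V) : Prop where
  transitive : IsTransitiveGraph G
  unimodular : ∀ x y, (stabilizerOrbit G x y).encard = (stabilizerOrbit G y x).encard

/-! Every vertex numbers its neighbors by distinct elements of `Fin d`, uniformly and independently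
of the other vertices. An edge then carries an unordered pair of numbers, one from each end, and
there are d(d+1)/2 such pairs. The edges with a given pair {i, j} form a graph of degree at most 2,
since a vertex gives i to at most one neighbor and likewise j. Given the numbers, these graphs are
3-colored independently of each other. The color of a vertex is the tuple of its 3-colors, and it is
proper because every edge lies in one of the graphs.

The 3-coloring of a finite union of paths and cycles is grown by random insertions of vertices. Its
weights satisfy two identities: summing over the color of a vertex with at most one neighbor deletes
that vertex (`sum_pathWeight_update`), and summing over the colors of two adjacent vertices deletes
both (`sum_sum_pathWeight_update`). Hence an edge with no end in F can be erased without changing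
the law of the colors on F (`localWeight_deleteEdge`). This law therefore depends only on the edges
that meet F (`localWeight_eq`), which gives a meaning to the coloring of infinite graphs, and it
factorizes over sets with disjoint closed neighborhoods (`localWeight_union`).

After averaging over the numbers, the colors on F involve only the numbers given by the vertices of
the closed neighborhood of F. Sets at distance greater than 2 have disjoint closed neighborhoods, so
the coloring is 2-dependent (`coloringLaw_isDependent`). Kolmogorov extension turns the finite
marginals into a law.

The law is attached to the graph alone: it ignores roots and commutes with isomorphisms
(`coloringLaw_map_iso`). A mass transport on colored graphs thus averages to one on uncolored
graphs, and unimodularity is inherited. The measurability needed for this comes from locality: the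
law of the colors in a ball of radius r is determined by the ball of radius r + 2. -/

/-! ### Random 3-colorings of finite paths and cycles by insertion -/

section PathColoring

open scoped Classical

variable {V V' : Type*}

/-- Every vertex has at most two neighbors: the components are paths and cycles. -/
def SimpleGraph.DegreeLETwo (H : SimpleGraph V) : Prop :=
  ∀ x a b c, H.Adj x a → H.Adj x b → H.Adj x c → a = b ∨ a = c ∨ b = c

/-- The graph obtained by removing the vertex `w` and joining its neighbors to each other. -/
def SimpleGraph.bypass (H : SimpleGraph V) (w : V) : SimpleGraph V where
  Adj a b := a ≠ b ∧ a ≠ w ∧ b ≠ w ∧ (H.Adj a b ∨ (H.Adj a w ∧ H.Adj w b))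
  symm := ⟨fun _ _ h => ⟨h.1.symm, h.2.2.1, h.2.1, h.2.2.2.imp (fun k => k.symm)
    (fun k => ⟨k.2.symm, k.1.symm⟩)⟩⟩
  loopless := ⟨fun _ h => h.1 rfl⟩

theorem SimpleGraph.bypass_adj (H : SimpleGraph V) (w a b : V) :
    (H.bypass w).Adj a b ↔
      a ≠ b ∧ a ≠ w ∧ b ≠ w ∧ (H.Adj a b ∨ (H.Adj a w ∧ H.Adj w b)) := Iff.rfl

theorem SimpleGraph.DegreeLETwo.bypass {H : SimpleGraph V} (h : H.DegreeLETwo) (w : V) :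
    (H.bypass w).DegreeLETwo := by
  intro x a b c ha hb hc
  rw [SimpleGraph.bypass_adj] at ha hb hc
  have h1 := h x
  have h2 := h w
  have := fun a b => H.adj_comm a b
  grind

/-- The coloring `c` is proper on the subgraph of `H` induced by `S`. -/
def ProperOn (H : SimpleGraph V) (S : Finset V) (c : V → Fin 3) : Prop :=
  ∀ x ∈ S, ∀ y ∈ S, H.Adj x y → c x ≠ c y

/-- The number of pairs of a vertex of `S` and a color avoided by its neighbors in `S`, provided
that the neighbors of every vertex have distinct colors. -/
noncomputable def freedom (H : SimpleGraph V) (S : Finset V) : ℝ :=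
  ∑ x ∈ S, (3 - ((S.filter (H.Adj x)).card : ℝ))

/-- Auxiliary recursion for `pathWeight`. -/
noncomputable def pathWeightAux : ℕ → SimpleGraph V → Finset V → (V → Fin 3) → ℝ
  | 0, _, _, _ => 1
  | n + 1, H, S, c => if ProperOn H S c then
      -- `w` is the vertex inserted last. Its neighbors are adjacent in `H.bypass w`, hence of
      -- distinct colors, so its number of admissible colors does not depend on `c` and `freedom H
      -- S` is a common denominator.
      (∑ w ∈ S, pathWeightAux n (H.bypass w) (S.erase w) c) / freedom H S else 0

/-- The probability of the coloring `c` of the subgraph of `H` induced by `S`, when it is grown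
from the empty graph by repeatedly inserting a vertex of a uniformly random admissible color. -/
noncomputable def pathWeight (H : SimpleGraph V) (S : Finset V) (c : V → Fin 3) : ℝ :=
  pathWeightAux S.card H S c

theorem pathWeight_empty (H : SimpleGraph V) (c : V → Fin 3) : pathWeight H ∅ c = 1 := rfl

theorem SimpleGraph.DegreeLETwo.card_le {H : SimpleGraph V} (h : H.DegreeLETwo) (S : Finset V)
    (x : V) : (S.filter (H.Adj x)).card ≤ 2 := by
  by_contra! hc
  obtain ⟨a, b, c, ha, hb, hc, h1, h2, h3⟩ := Finset.two_lt_card_iff.1 hc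
  simp only [Finset.mem_filter] at ha hb hc
  have := h x a b c ha.2 hb.2 hc.2
  tauto

theorem freedom_pos {H : SimpleGraph V} (h : H.DegreeLETwo) {S : Finset V} (hS : S.Nonempty) :
    0 < freedom H S := by
  refine Finset.sum_pos (fun x _ => ?_) hS
  have : ((S.filter (H.Adj x)).card : ℝ) ≤ 2 := by exact_mod_cast h.card_le S x
  linarith

theorem pathWeight_eq {H : SimpleGraph V} {S : Finset V} (hS : S.Nonempty) (c : V → Fin 3) :
    pathWeight H S c = if ProperOn H S c then
      (∑ w ∈ S, pathWeight (H.bypass w) (S.erase w) c) / freedom H S else 0 := by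
  obtain ⟨n, hn⟩ : ∃ n, S.card = n + 1 := ⟨S.card - 1, by have := hS.card_pos; omega⟩
  rw [pathWeight, hn, pathWeightAux]
  congr 2
  refine Finset.sum_congr rfl fun w hw => ?_
  rw [pathWeight, Finset.card_erase_of_mem hw, hn, Nat.add_sub_cancel]

theorem pathWeight_nonneg {H : SimpleGraph V} (h : H.DegreeLETwo) (S : Finset V)
    (c : V → Fin 3) : 0 ≤ pathWeight H S c := by
  induction hn : S.card generalizing H S with
  | zero => rw [Finset.card_eq_zero.1 hn, pathWeight_empty]; exact zero_le_one
  | succ n ih =>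
    have hS : S.Nonempty := Finset.card_pos.1 (by omega)
    rw [pathWeight_eq hS]
    split_ifs
    · exact div_nonneg (Finset.sum_nonneg fun w hw => ih (h.bypass w) _ (by
        rw [Finset.card_erase_of_mem hw]; omega)) (freedom_pos h hS).le
    · exact le_rfl

theorem freedom_mul_pathWeight {H : SimpleGraph V} (h : H.DegreeLETwo) (S : Finset V)
    (c : V → Fin 3) :
    freedom H S * pathWeight H S c =
      if ProperOn H S c then ∑ w ∈ S, pathWeight (H.bypass w) (S.erase w) c else 0 := by
  rcases S.eq_empty_or_nonempty with rfl | hS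
  · simp [freedom]
  · rw [pathWeight_eq hS]
    split_ifs
    · rw [mul_div_cancel₀ _ (freedom_pos h hS).ne']
    · simp

theorem pathWeight_eq_zero {H : SimpleGraph V} {S : Finset V} {c : V → Fin 3}
    (hc : ¬ ProperOn H S c) : pathWeight H S c = 0 := by
  have hS : S.Nonempty := by
    rw [Finset.nonempty_iff_ne_empty]
    rintro rfl
    exact hc fun x hx => by simp at hx
  rw [pathWeight_eq hS, if_neg hc]

/-- The recursion uses only adjacency and colors within `S`, and `bypass` commutes with embeddings.
This invariance yields the contraction identity `pathWeight_bypass_swap` and ultimately the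
equivariance of the coloring. -/
theorem pathWeight_map (ι : V' ↪ V) {H' : SimpleGraph V'} {H : SimpleGraph V} {S : Finset V'}
    {c' : V' → Fin 3} {c : V → Fin 3} (hH : ∀ x ∈ S, ∀ y ∈ S, H'.Adj x y ↔ H.Adj (ι x) (ι y))
    (hc : ∀ x ∈ S, c' x = c (ι x)) :
    pathWeight H' S c' = pathWeight H (S.map ι) c := by
  induction hn : S.card generalizing H' H S with
  | zero => rw [Finset.card_eq_zero.1 hn, Finset.map_empty, pathWeight_empty, pathWeight_empty]
  | succ n ih =>
    have hS : S.Nonempty := Finset.card_pos.1 (by omega)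
    rw [pathWeight_eq hS, pathWeight_eq (Finset.map_nonempty.2 hS)]
    have h1 : ProperOn H' S c' ↔ ProperOn H (S.map ι) c := by
      simp only [ProperOn, Finset.forall_mem_map]
      refine forall₂_congr fun x hx => forall₂_congr fun y hy => ?_
      rw [hH x hx y hy, hc x hx, hc y hy]
    have h2 : freedom H' S = freedom H (S.map ι) := by
      simp only [freedom, Finset.sum_map]
      refine Finset.sum_congr rfl fun x hx => ?_
      congr 2
      rw [Finset.filter_map, Finset.card_map]
      congr 1
      refine Finset.filter_congr fun y hy => ?_
      simpa using hH x hx y hy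
    simp only [h1, h2, Finset.sum_map]
    congr 2
    refine Finset.sum_congr rfl fun w hw => ?_
    rw [← Finset.map_erase]
    refine ih (fun x hx y hy => ?_) (fun x hx => hc x (Finset.mem_of_mem_erase hx)) (by
        rw [Finset.card_erase_of_mem hw]; omega)
    have hx' := Finset.mem_of_mem_erase hx
    have hy' := Finset.mem_of_mem_erase hy
    simp only [SimpleGraph.bypass_adj, hH x hx' y hy', hH x hx' w hw, hH w hw y hy',
      ne_eq, EmbeddingLike.apply_eq_iff_eq]

theorem pathWeight_congr {H H' : SimpleGraph V} {S : Finset V} {c c' : V → Fin 3}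
    (hH : ∀ x ∈ S, ∀ y ∈ S, H'.Adj x y ↔ H.Adj x y) (hc : ∀ x ∈ S, c' x = c x) :
    pathWeight H' S c' = pathWeight H S c := by
  have := pathWeight_map (Function.Embedding.refl V) hH hc
  rwa [Finset.map_refl] at this

/-- Bypassing either end contracts the edge `uw`, so exchanging `u` and `w` identifies the two
results. By the degree bound each end has at most one further neighbor, so no edge appears between
two other vertices. -/
theorem pathWeight_bypass_swap {H : SimpleGraph V} (h : H.DegreeLETwo) {S : Finset V} {u w : V}
    (hu : u ∈ S) (hw : w ∈ S) (huw : H.Adj u w) {c c' : V → Fin 3} (h1 : c' u = c w)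
    (h2 : ∀ x ∈ S, x ≠ u → x ≠ w → c' x = c x) :
    pathWeight (H.bypass w) (S.erase w) c' = pathWeight (H.bypass u) (S.erase u) c := by
  have hne : u ≠ w := huw.ne
  have hS : (S.erase w).map (Equiv.swap u w).toEmbedding = S.erase u := by
    ext x
    simp only [Finset.mem_map_equiv, Equiv.symm_swap, Finset.mem_erase]
    grind
  rw [← hS]
  refine pathWeight_map _ (fun x hx y hy => ?_) (fun x hx => ?_)
  · have hxw := Finset.ne_of_mem_erase hx
    have hyw := Finset.ne_of_mem_erase hy
    have := fun a b => H.adj_comm a b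
    have h3 := h u
    have h4 := h w
    simp only [SimpleGraph.bypass_adj, Equiv.coe_toEmbedding, Equiv.swap_apply_def]
    grind
  · have hxw := Finset.ne_of_mem_erase hx
    have hxS := Finset.mem_of_mem_erase hx
    simp only [Equiv.coe_toEmbedding, Equiv.swap_apply_def]
    grind

end PathColoring

/-! ### The two summation identities -/

section PathColoring

open scoped Classical
open Function

variable {V V' : Type*}

/-- An edge at `u` costs one choice at each of its ends, whence the factor 2. -/
theorem freedom_erase (H : SimpleGraph V) {S : Finset V} {u : V} (hu : u ∈ S) :
    freedom H S = freedom H (S.erase u) + 3 - 2 * (((S.erase u).filter (H.Adj u)).card : ℝ) := by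
  have h1 : S.filter (H.Adj u) = (S.erase u).filter (H.Adj u) := by
    ext x
    simp only [Finset.mem_filter, Finset.mem_erase]
    have := H.loopless.irrefl u
    grind
  have h2 : ∀ x ∈ S.erase u, (3 - ((S.filter (H.Adj x)).card : ℝ)) =
      (3 - (((S.erase u).filter (H.Adj x)).card : ℝ)) - if H.Adj u x then 1 else 0 := by
    intro x hx
    have : S = insert u (S.erase u) := (Finset.insert_erase hu).symm
    conv_lhs => rw [this, Finset.filter_insert]
    rw [H.adj_comm u x]
    split_ifs
    · rw [Finset.card_insert_of_notMem (by simp)]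
      push_cast
      ring
    · ring
  rw [freedom, ← Finset.add_sum_erase _ _ hu, Finset.sum_congr rfl h2, Finset.sum_sub_distrib,
    Finset.sum_boole, h1, freedom]
  ring

theorem properOn_update {H : SimpleGraph V} {S : Finset V} {u : V} (hu : u ∈ S)
    (c : V → Fin 3) (a : Fin 3) : ProperOn H S (update c u a) ↔
      ProperOn H (S.erase u) c ∧ ∀ s ∈ (S.erase u).filter (H.Adj u), a ≠ c s := by
  have := fun a b => H.adj_comm a b
  have := H.loopless.irrefl u
  simp only [ProperOn, Finset.mem_filter, Finset.mem_erase, update_apply]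
  constructor
  · intro h
    refine ⟨fun x hx y hy hxy => ?_, fun s hs => ?_⟩
    · have := h x hx.2 y hy.2 hxy
      rwa [if_neg hx.1, if_neg hy.1] at this
    · have := h u hu s hs.1.2 hs.2
      rwa [if_pos rfl, if_neg hs.1.1] at this
  · rintro ⟨h1, h2⟩ x hx y hy hxy
    grind

/-- Summing over the color of a vertex with at most one neighbor deletes the vertex. -/
theorem sum_pathWeight_update {H : SimpleGraph V} (h : H.DegreeLETwo) {S : Finset V} {u : V}
    (hu : u ∈ S) (hu1 : ∀ x ∈ S, ∀ y ∈ S, H.Adj u x → H.Adj u y → x = y) (c : V → Fin 3) :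
    ∑ a, pathWeight H S (update c u a) = pathWeight H (S.erase u) c := by
  induction hn : S.card generalizing H S c with
  | zero => simp [Finset.card_eq_zero.1 hn] at hu
  | succ n ih =>
    -- Let p be the weight without `u`. After multiplication by `freedom H S` and unfolding of the
    -- recursion, the term `w = u` gives (3 - |A|) p, and by induction the other terms give
    -- (`freedom H (S.erase u)` - |A|) p. The coefficients add up to `freedom H S`.
    refine mul_left_cancel₀ (freedom_pos h ⟨u, hu⟩).ne' ?_
    set A := (S.erase u).filter (H.Adj u) with hA
    have hAcard : A.card ≤ 1 := Finset.card_le_one.2 fun x hx y hy => by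
      simp only [hA, Finset.mem_filter, Finset.mem_erase] at hx hy
      exact hu1 x hx.1.2 y hy.1.2 hx.2 hy.2
    rw [Finset.mul_sum]
    simp only [freedom_mul_pathWeight h, properOn_update hu, ← hA]
    by_cases hQ : ProperOn H (S.erase u) c
    swap
    · simp [hQ, pathWeight_eq_zero hQ]
    simp only [hQ, true_and]
    -- With at most one neighbor in `S`, bypassing `u` creates no edge.
    have hp : pathWeight (H.bypass u) (S.erase u) c = pathWeight H (S.erase u) c := by
      refine pathWeight_congr (fun x hx y hy => ?_) fun _ _ => rfl
      simp only [Finset.mem_erase] at hx hy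
      have := fun a b => H.adj_comm a b
      have := H.ne_of_adj (a := x) (b := y)
      rw [SimpleGraph.bypass_adj]
      grind
    have hcount : ∑ a : Fin 3, (if ∀ s ∈ A, a ≠ c s then pathWeight H (S.erase u) c else 0) =
        (3 - (A.card : ℝ)) * pathWeight H (S.erase u) c := by
      rcases Nat.le_one_iff_eq_zero_or_eq_one.1 hAcard with h0 | h1
      · rw [Finset.card_eq_zero.1 h0]
        simp
      · obtain ⟨s, hs⟩ := Finset.card_eq_one.1 h1
        rw [hs]
        simp only [Finset.mem_singleton, forall_eq]
        have : ∀ a : Fin 3, (if a ≠ c s then pathWeight H (S.erase u) c else 0) =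
          pathWeight H (S.erase u) c - if a = c s then pathWeight H (S.erase u) c else 0 := by
          intro a
          split_ifs <;> simp_all
        rw [Finset.sum_congr rfl fun a _ => this a, Finset.sum_sub_distrib]
        simp
        ring
    have hterm : ∀ w ∈ S.erase u,
        ∑ a, (if ∀ s ∈ A, a ≠ c s then
          pathWeight (H.bypass w) (S.erase w) (update c u a) else 0) =
        pathWeight (H.bypass w) ((S.erase u).erase w) c -
          if H.Adj u w then pathWeight H (S.erase u) c else 0 := by
      intro w hw
      have hwu := Finset.ne_of_mem_erase hw
      have hwS := Finset.mem_of_mem_erase hw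
      have huw : u ∈ S.erase w := Finset.mem_erase.2 ⟨hwu.symm, hu⟩
      -- In `H.bypass w` the color of `u` already avoids those of its neighbors other than `w`;
      -- properness in `H` excludes in addition only `a = c w`, when `w` is a neighbor of `u`.
      have key : ∀ a, (if ∀ s ∈ A, a ≠ c s then
            pathWeight (H.bypass w) (S.erase w) (update c u a) else 0) =
          pathWeight (H.bypass w) (S.erase w) (update c u a) -
          if a = c w then (if H.Adj u w then
            pathWeight (H.bypass w) (S.erase w) (update c u a) else 0) else 0 := by
        intro a
        by_cases hX : pathWeight (H.bypass w) (S.erase w) (update c u a) = 0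
        · simp [hX]
        have hpr : ProperOn (H.bypass w) (S.erase w) (update c u a) := by
          by_contra hc
          exact hX (pathWeight_eq_zero hc)
        have h3 : ∀ s ∈ A, s ≠ w → a ≠ c s := by
          intro s hs hsw
          simp only [hA, Finset.mem_filter, Finset.mem_erase] at hs
          refine ((properOn_update huw _ _).1 hpr).2 s ?_
          simp only [Finset.mem_filter, Finset.mem_erase, SimpleGraph.bypass_adj]
          exact ⟨⟨hs.1.1, hsw, hs.1.2⟩, hs.1.1.symm, hwu.symm, hsw, Or.inl hs.2⟩
        have h4 : w ∈ A ↔ H.Adj u w := by simp [hA, hwu, hwS]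
        grind
      rw [Finset.sum_congr rfl fun a _ => key a, Finset.sum_sub_distrib,
        Finset.sum_ite_eq' Finset.univ (c w), if_pos (Finset.mem_univ _),
        ih (h.bypass w) huw, Finset.erase_right_comm]
      · congr 1
        split_ifs with hadj
        · rw [← hp]
          refine pathWeight_bypass_swap h hu hwS hadj (by simp) fun x _ hx _ => by simp [hx]
        · rfl
      -- The induction hypothesis applies: if `w` was the neighbor of `u`, it is replaced by the
      -- other neighbor of `w`, if any.
      · intro x hx y hy hux huy
        rw [SimpleGraph.bypass_adj] at hux huy
        have := fun a b => H.adj_comm a b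
        have := h w
        simp only [Finset.mem_erase] at hx hy
        grind
      · rw [Finset.card_erase_of_mem hwS, hn, Nat.add_sub_cancel]
    have hsplit : ∀ a, (if ∀ s ∈ A, a ≠ c s then
          ∑ w ∈ S, pathWeight (H.bypass w) (S.erase w) (update c u a) else 0) =
        (if ∀ s ∈ A, a ≠ c s then pathWeight H (S.erase u) c else 0) +
        ∑ w ∈ S.erase u, (if ∀ s ∈ A, a ≠ c s then
          pathWeight (H.bypass w) (S.erase w) (update c u a) else 0) := by
      intro a
      split_ifs with ha
      · rw [← Finset.add_sum_erase _ _ hu, ← hp]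
        congr 1
        refine pathWeight_congr (fun _ _ _ _ => Iff.rfl) fun x hx => ?_
        simp [Finset.ne_of_mem_erase hx]
      · simp
    rw [Finset.sum_congr rfl fun a _ => hsplit a, Finset.sum_add_distrib, hcount,
      Finset.sum_comm, Finset.sum_congr rfl hterm, Finset.sum_sub_distrib, freedom_erase H hu,
      ← hA]
    have h5 := freedom_mul_pathWeight h (S.erase u) c
    rw [if_pos hQ] at h5
    rw [← h5, ← Finset.sum_filter, ← hA]
    simp
    ring

/-- Summing over the colors of two adjacent vertices deletes both of them. -/
theorem sum_sum_pathWeight_update {H : SimpleGraph V} (h : H.DegreeLETwo) {S : Finset V} {u v : V}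
    (hu : u ∈ S) (hv : v ∈ S) (huv : H.Adj u v) (c : V → Fin 3) :
    ∑ a, ∑ b, pathWeight H S (update (update c u a) v b) =
      pathWeight H ((S.erase u).erase v) c := by
  induction hn : S.card generalizing H S c with
  | zero => simp [Finset.card_eq_zero.1 hn] at hu
  | succ n ih =>
    -- Let p be the weight on `T` and σ = ∑ b, f b with `f` as below. The terms `w = u` and `w = v`
    -- give (2 - |A|) σ and (2 - |B|) σ, the others give `freedom H T` · p - (|A| + |B|) σ. By
    -- `hfree` it remains to replace σ by p in (4 - 2|A| - 2|B|) σ.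
    refine mul_left_cancel₀ (freedom_pos h ⟨u, hu⟩).ne' ?_
    have huv' : u ≠ v := huv.ne
    have hvu : v ∈ S.erase u := Finset.mem_erase.2 ⟨huv'.symm, hv⟩
    set T := (S.erase u).erase v with hT
    have hTmem : ∀ x, x ∈ T ↔ x ≠ v ∧ x ≠ u ∧ x ∈ S := by simp [hT]
    set A := T.filter (H.Adj u) with hA
    set B := T.filter (H.Adj v) with hB
    have hAmem : ∀ x, x ∈ A ↔ (x ≠ v ∧ x ≠ u ∧ x ∈ S) ∧ H.Adj u x := by simp [hA, hTmem]
    have hBmem : ∀ x, x ∈ B ↔ (x ≠ v ∧ x ≠ u ∧ x ∈ S) ∧ H.Adj v x := by simp [hB, hTmem]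
    have hAcard : A.card ≤ 1 := Finset.card_le_one.2 fun x hx y hy => by
      rw [hAmem] at hx hy
      have := h u v x y huv hx.2 hy.2
      grind
    have hBcard : B.card ≤ 1 := Finset.card_le_one.2 fun x hx y hy => by
      rw [hBmem] at hx hy
      have := h v u x y huv.symm hx.2 hy.2
      grind
    have hfree : freedom H S = freedom H T + (4 - 2 * (A.card : ℝ) - 2 * (B.card : ℝ)) := by
      have h1 : (S.erase u).filter (H.Adj u) = insert v A := by
        ext x
        simp only [Finset.mem_filter, Finset.mem_erase, Finset.mem_insert, hAmem]
        grind
      rw [freedom_erase H hu, freedom_erase H hvu, h1,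
        Finset.card_insert_of_notMem (by simp [hAmem])]
      push_cast
      ring
    have hproper : ∀ a b, ProperOn H S (update (update c u a) v b) ↔
        ProperOn H T c ∧ (∀ s ∈ A, a ≠ c s) ∧ (∀ s ∈ B, b ≠ c s) ∧ a ≠ b := by
      intro a b
      rw [update_comm huv', properOn_update hu, properOn_update hvu]
      simp only [← hT, ← hB, and_assoc, Finset.mem_filter, Finset.mem_erase, hAmem]
      have e1 : ∀ s, s ≠ v → update c v b s = c s := fun s hs => update_of_ne hs _ _
      have e2 : update c v b v = b := update_self ..
      refine and_congr_right fun _ => ?_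
      grind
    rw [Finset.mul_sum]
    simp only [Finset.mul_sum]
    simp only [freedom_mul_pathWeight h, hproper]
    by_cases hQ : ProperOn H T c
    swap
    · simp [hQ, pathWeight_eq_zero hQ]
    simp only [hQ, true_and]
    -- The weight after contraction of the edge `uv` to a vertex of color `b`; by `hfv` it does not
    -- matter which end is kept.
    set f : Fin 3 → ℝ := fun b => pathWeight (H.bypass u) (S.erase u) (update c v b) with hf
    have hfv : ∀ a, pathWeight (H.bypass v) (S.erase v) (update c u a) = f a := fun a =>
      pathWeight_bypass_swap h hu hv huv (by simp) fun x _ hxu hxv => by simp [hxu, hxv]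
    -- The contracted vertex inherits the neighbors of both ends, so its color avoids theirs.
    have hf0 : ∀ b, f b ≠ 0 → (∀ s ∈ A, b ≠ c s) ∧ (∀ s ∈ B, b ≠ c s) := by
      intro b hb
      have hpr : ProperOn (H.bypass u) (S.erase u) (update c v b) := by
        by_contra hc
        exact hb (pathWeight_eq_zero hc)
      have h2 := ((properOn_update hvu _ _).1 hpr).2
      constructor
      · intro s hs
        rw [hAmem] at hs
        refine h2 s ?_
        simp only [Finset.mem_filter, Finset.mem_erase, SimpleGraph.bypass_adj]
        exact ⟨hs.1, hs.1.1.symm, huv'.symm, hs.1.2.1, Or.inr ⟨huv.symm, hs.2⟩⟩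
      · intro s hs
        rw [hBmem] at hs
        refine h2 s ?_
        simp only [Finset.mem_filter, Finset.mem_erase, SimpleGraph.bypass_adj]
        exact ⟨hs.1, hs.1.1.symm, huv'.symm, hs.1.2.1, Or.inl hs.2⟩
    have hcount : ∀ (E : Finset V), E.card ≤ 1 → ∀ b, (∀ s ∈ E, b ≠ c s) →
        ∀ r : ℝ, ∑ a, (if (∀ s ∈ E, a ≠ c s) ∧ a ≠ b then r else 0) = (2 - (E.card : ℝ)) * r := by
      intro E hE b hb r
      rw [← Finset.sum_filter, Finset.sum_const, nsmul_eq_mul]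
      congr 1
      rcases Nat.le_one_iff_eq_zero_or_eq_one.1 hE with h0 | h1
      · rw [Finset.card_eq_zero.1 h0]
        have : (Finset.univ.filter fun a : Fin 3 => a ≠ b).card = 2 := by
          clear hb; revert b; decide
        simp [this]
      · obtain ⟨s, hs⟩ := Finset.card_eq_one.1 h1
        rw [hs] at hb ⊢
        simp only [Finset.mem_singleton, forall_eq] at hb ⊢
        have : ∀ b t : Fin 3, b ≠ t →
            (Finset.univ.filter fun a : Fin 3 => a ≠ t ∧ a ≠ b).card = 1 := by decide
        rw [this _ _ hb]
        norm_num
    have hU : ∑ a, ∑ b, (if (∀ s ∈ A, a ≠ c s) ∧ (∀ s ∈ B, b ≠ c s) ∧ a ≠ b then f b else 0) =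
        (2 - (A.card : ℝ)) * ∑ b, f b := by
      rw [Finset.sum_comm, Finset.mul_sum]
      refine Finset.sum_congr rfl fun b _ => ?_
      by_cases hb : f b = 0
      · simp [hb]
      · rw [← hcount A hAcard b (hf0 b hb).1]
        refine Finset.sum_congr rfl fun a _ => ?_
        have h1 := (hf0 b hb).2
        congr 1
        exact propext ⟨fun h => ⟨h.1, h.2.2⟩, fun h => ⟨h.1, h1, h.2⟩⟩
    have hV : ∑ a, ∑ b, (if (∀ s ∈ A, a ≠ c s) ∧ (∀ s ∈ B, b ≠ c s) ∧ a ≠ b then f a else 0) =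
        (2 - (B.card : ℝ)) * ∑ b, f b := by
      rw [Finset.mul_sum]
      refine Finset.sum_congr rfl fun a _ => ?_
      by_cases ha : f a = 0
      · simp [ha]
      · rw [← hcount B hBcard a (hf0 a ha).2]
        refine Finset.sum_congr rfl fun b _ => ?_
        have h1 := (hf0 a ha).1
        congr 1
        exact propext ⟨fun h => ⟨h.2.1, h.2.2.symm⟩, fun h => ⟨h1, h.1, h.2.symm⟩⟩
    have hterm : ∀ w ∈ T,
        ∑ a, ∑ b, (if (∀ s ∈ A, a ≠ c s) ∧ (∀ s ∈ B, b ≠ c s) ∧ a ≠ b then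
          pathWeight (H.bypass w) (S.erase w) (update (update c u a) v b) else 0) =
        pathWeight (H.bypass w) (T.erase w) c - (if H.Adj u w then ∑ b, f b else 0) -
          (if H.Adj v w then ∑ b, f b else 0) := by
      intro w hw
      obtain ⟨hwv, hwu, hwS⟩ := (hTmem w).1 hw
      have huw : u ∈ S.erase w := Finset.mem_erase.2 ⟨hwu.symm, hu⟩
      have hvw : v ∈ S.erase w := Finset.mem_erase.2 ⟨hwv.symm, hv⟩
      have hvuw : v ∈ (S.erase w).erase u := Finset.mem_erase.2 ⟨huv'.symm, hvw⟩
      have huv2 : (H.bypass w).Adj u v := ⟨huv', hwu.symm, hwv.symm, Or.inl huv⟩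
      set X : Fin 3 → Fin 3 → ℝ := fun a b =>
        pathWeight (H.bypass w) (S.erase w) (update (update c u a) v b) with hX
      -- The excluded cases `a = c w` and `b = c w` cannot occur together where `X a b ≠ 0`, since
      -- there `a ≠ b`; so both are simply subtracted.
      have key : ∀ a b, (if (∀ s ∈ A, a ≠ c s) ∧ (∀ s ∈ B, b ≠ c s) ∧ a ≠ b then
            X a b else 0) =
          X a b - (if a = c w then (if H.Adj u w then X a b else 0) else 0)
           - (if b = c w then (if H.Adj v w then X a b else 0) else 0) := by
        intro a b
        by_cases hX0 : X a b = 0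
        · simp [hX0]
        have hpr : ProperOn (H.bypass w) (S.erase w) (update (update c u a) v b) := by
          by_contra hc
          exact hX0 (pathWeight_eq_zero hc)
        have hab : a ≠ b := by
          have := hpr u huw v hvw huv2
          rwa [update_self, update_of_ne huv', update_self] at this
        have hne : ∀ s, s ≠ u → s ≠ v → update (update c u a) v b s = c s := fun s h1 h2 => by
          rw [update_of_ne h2, update_of_ne h1]
        have h3 : ∀ s ∈ A, s ≠ w → a ≠ c s := by
          intro s hs hsw
          obtain ⟨⟨hsv, hsu, hsS⟩, hus⟩ := (hAmem s).1 hs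
          have := hpr u huw s (Finset.mem_erase.2 ⟨hsw, hsS⟩)
            ⟨hsu.symm, hwu.symm, hsw, Or.inl hus⟩
          rwa [hne s hsu hsv, update_of_ne huv', update_self] at this
        have h3' : ∀ s ∈ B, s ≠ w → b ≠ c s := by
          intro s hs hsw
          obtain ⟨⟨hsv, hsu, hsS⟩, hus⟩ := (hBmem s).1 hs
          have := hpr v hvw s (Finset.mem_erase.2 ⟨hsw, hsS⟩)
            ⟨hsv.symm, hwv.symm, hsw, Or.inl hus⟩
          rwa [hne s hsu hsv, update_self] at this
        have h4 : w ∈ A ↔ H.Adj u w := by simp [hAmem, hwu, hwv, hwS]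
        have h4' : w ∈ B ↔ H.Adj v w := by simp [hBmem, hwu, hwv, hwS]
        grind
      have e1 : ∑ a, ∑ b, X a b = pathWeight (H.bypass w) (T.erase w) c := by
        rw [ih (h.bypass w) huw hvw huv2, hT]
        · congr 1
          ext x
          simp only [Finset.mem_erase]
          tauto
        · rw [Finset.card_erase_of_mem hwS, hn, Nat.add_sub_cancel]
      have e2 : H.Adj u w → ∑ b, X (c w) b = ∑ b, f b := fun hadj =>
        Finset.sum_congr rfl fun b _ => pathWeight_bypass_swap h hu hwS hadj
          (by simp [huv', hwv]) fun x _ hxu hxw => by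
            by_cases hxv : x = v
            · simp [hxv]
            · simp [hxu, hxv]
      have e3 : H.Adj v w → ∑ a, X a (c w) = ∑ b, f b := fun hadj =>
        Finset.sum_congr rfl fun a _ => by
          rw [← hfv]
          refine pathWeight_bypass_swap h hv hwS hadj (by simp [hwu]) fun x _ hxv hxw => by
            simp [hxv]
      have e4 : ∑ a, ∑ b, (if a = c w then (if H.Adj u w then X a b else 0) else 0) =
          if H.Adj u w then ∑ b, f b else 0 := by
        rw [Finset.sum_comm]
        simp only [Finset.sum_ite_eq', Finset.mem_univ, if_true]
        split_ifs with hadj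
        · exact e2 hadj
        · simp
      have e5 : ∑ a, ∑ b, (if b = c w then (if H.Adj v w then X a b else 0) else 0) =
          if H.Adj v w then ∑ b, f b else 0 := by
        simp only [Finset.sum_ite_eq', Finset.mem_univ, if_true]
        split_ifs with hadj
        · exact e3 hadj
        · simp
      refine (Finset.sum_congr rfl fun a _ => Finset.sum_congr rfl fun b _ => key a b).trans ?_
      simp only [Finset.sum_sub_distrib]
      rw [e1, e4, e5]
    have hsplit : ∀ a b, (if (∀ s ∈ A, a ≠ c s) ∧ (∀ s ∈ B, b ≠ c s) ∧ a ≠ b then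
          ∑ w ∈ S, pathWeight (H.bypass w) (S.erase w) (update (update c u a) v b) else 0) =
        (if (∀ s ∈ A, a ≠ c s) ∧ (∀ s ∈ B, b ≠ c s) ∧ a ≠ b then f b else 0) +
        ((if (∀ s ∈ A, a ≠ c s) ∧ (∀ s ∈ B, b ≠ c s) ∧ a ≠ b then f a else 0) +
        ∑ w ∈ T, (if (∀ s ∈ A, a ≠ c s) ∧ (∀ s ∈ B, b ≠ c s) ∧ a ≠ b then
          pathWeight (H.bypass w) (S.erase w) (update (update c u a) v b) else 0)) := by
      intro a b
      split_ifs with hab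
      · rw [← Finset.add_sum_erase _ _ hu, ← Finset.add_sum_erase _ _ hvu]
        congr 1
        · refine pathWeight_congr (fun _ _ _ _ => Iff.rfl) fun x hx => ?_
          rw [update_comm huv', update_of_ne (Finset.ne_of_mem_erase hx)]
        · congr 1
          rw [← hfv]
          refine pathWeight_congr (fun _ _ _ _ => Iff.rfl) fun x hx => ?_
          rw [update_of_ne (Finset.ne_of_mem_erase hx)]
      · simp
    simp only [hsplit, Finset.sum_add_distrib]
    have hswap : ∑ a, ∑ b, ∑ w ∈ T, (if (∀ s ∈ A, a ≠ c s) ∧ (∀ s ∈ B, b ≠ c s) ∧ a ≠ b then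
          pathWeight (H.bypass w) (S.erase w) (update (update c u a) v b) else 0) =
        ∑ w ∈ T, ∑ a, ∑ b, (if (∀ s ∈ A, a ≠ c s) ∧ (∀ s ∈ B, b ≠ c s) ∧ a ≠ b then
          pathWeight (H.bypass w) (S.erase w) (update (update c u a) v b) else 0) := by
      rw [Finset.sum_comm (s := T)]
      exact Finset.sum_congr rfl fun a _ => Finset.sum_comm
    rw [hU, hV, hswap, Finset.sum_congr rfl hterm, Finset.sum_sub_distrib,
      Finset.sum_sub_distrib, ← Finset.sum_filter, ← Finset.sum_filter, ← hA, ← hB,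
      Finset.sum_const, Finset.sum_const, nsmul_eq_mul, nsmul_eq_mul, hfree]
    have h5 := freedom_mul_pathWeight h T c
    rw [if_pos hQ] at h5
    rw [← h5]
    -- If both ends have a further neighbor, the coefficient vanishes, thanks to the number 3 of
    -- colors. Otherwise the contracted vertex has at most one neighbor and `sum_pathWeight_update`
    -- gives σ = p.
    have hF : (4 - 2 * (A.card : ℝ) - 2 * (B.card : ℝ)) * ∑ b, f b =
        (4 - 2 * (A.card : ℝ) - 2 * (B.card : ℝ)) * pathWeight H T c := by
      by_cases hAB : A.card = 1 ∧ B.card = 1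
      · rw [hAB.1, hAB.2]
        norm_num
      congr 1
      have hone : A = ∅ ∨ B = ∅ := by
        rw [← Finset.card_eq_zero, ← Finset.card_eq_zero]
        omega
      rw [Finset.card_le_one] at hAcard hBcard
      rw [hf, sum_pathWeight_update (h.bypass u) hvu]
      · refine pathWeight_congr (fun x hx y hy => ?_) fun _ _ => rfl
        rw [hTmem] at hx hy
        have := fun a b => H.adj_comm a b
        have := H.ne_of_adj (a := x) (b := y)
        rw [SimpleGraph.bypass_adj]
        have h1 := hAcard x
        simp only [hAmem] at h1
        grind
      · intro x hx y hy hvx hvy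
        rw [SimpleGraph.bypass_adj] at hvx hvy
        rw [Finset.mem_erase] at hx hy
        rw [Finset.eq_empty_iff_forall_notMem, Finset.eq_empty_iff_forall_notMem] at hone
        have h1 := hAcard x
        have h2 := hBcard x
        simp only [hAmem, hBmem] at hone h1 h2
        have h3 := hvx.1
        have h4 := hvy.1
        rcases hone with hone | hone <;> have h6 := hone x <;> have h7 := hone y <;> grind
    linear_combination hF

end PathColoring

/-! ### Independence of components, marginals -/

section PathColoring

open scoped Classical
open Function

variable {V V' : Type*}

theorem freedom_union {H : SimpleGraph V} {S T : Finset V} (hST : Disjoint S T)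
    (hH : ∀ x ∈ S, ∀ y ∈ T, ¬ H.Adj x y) : freedom H (S ∪ T) = freedom H S + freedom H T := by
  rw [freedom, Finset.sum_union hST, freedom, freedom]
  congr 1 <;> refine Finset.sum_congr rfl fun x hx => ?_
  · rw [Finset.filter_union, Finset.filter_false_of_mem (hH x hx), Finset.union_empty]
  · rw [Finset.filter_union, Finset.filter_false_of_mem (s := S) fun y hy h => hH y hy x hx h.symm,
      Finset.empty_union]

/-- The last inserted vertex lies in one of the two pieces. By induction the two parts of the sum
are `freedom H S` and `freedom H T` times the product, and freedom is additive. -/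
theorem pathWeight_union {H : SimpleGraph V} (h : H.DegreeLETwo) {S T : Finset V}
    (hST : Disjoint S T) (hH : ∀ x ∈ S, ∀ y ∈ T, ¬ H.Adj x y) (c : V → Fin 3) :
    pathWeight H (S ∪ T) c = pathWeight H S c * pathWeight H T c := by
  induction hn : (S ∪ T).card generalizing H S T with
  | zero =>
    obtain ⟨rfl, rfl⟩ := Finset.union_eq_empty.1 (Finset.card_eq_zero.1 hn)
    simp [pathWeight_empty]
  | succ n ih =>
    refine mul_left_cancel₀ (freedom_pos h (S := S ∪ T) (Finset.card_pos.1 (by omega))).ne' ?_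
    rw [freedom_mul_pathWeight h]
    have hproper : ProperOn H (S ∪ T) c ↔ ProperOn H S c ∧ ProperOn H T c := by
      have := fun a b => H.adj_comm a b
      simp only [ProperOn, Finset.mem_union]
      grind
    have h1 : ∀ w ∈ S, pathWeight (H.bypass w) ((S ∪ T).erase w) c =
        pathWeight (H.bypass w) (S.erase w) c * pathWeight H T c := by
      intro w hw
      have hwT : w ∉ T := Finset.disjoint_left.1 hST hw
      rw [Finset.erase_union_distrib, Finset.erase_eq_of_notMem hwT, ih (h.bypass w)]
      · congr 1
        refine pathWeight_congr (fun x hx y hy => ?_) fun _ _ => rfl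
        have := hH w hw y hy
        have := H.ne_of_adj (a := x) (b := y)
        rw [SimpleGraph.bypass_adj]
        grind
      · exact hST.mono_left (Finset.erase_subset _ _)
      · intro x hx y hy hxy
        rw [SimpleGraph.bypass_adj] at hxy
        have := hH w hw y hy
        have := hH x (Finset.mem_of_mem_erase hx) y hy
        tauto
      · have := Finset.card_erase_of_mem (Finset.mem_union_left T hw)
        rw [Finset.erase_union_distrib, Finset.erase_eq_of_notMem hwT] at this
        omega
    have h2 : ∀ w ∈ T, pathWeight (H.bypass w) ((S ∪ T).erase w) c =
        pathWeight H S c * pathWeight (H.bypass w) (T.erase w) c := by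
      intro w hw
      have hwS : w ∉ S := Finset.disjoint_right.1 hST hw
      rw [Finset.erase_union_distrib, Finset.erase_eq_of_notMem hwS, ih (h.bypass w)]
      · congr 1
        refine pathWeight_congr (fun x hx y hy => ?_) fun _ _ => rfl
        have := hH x hx w hw
        have := H.ne_of_adj (a := x) (b := y)
        rw [SimpleGraph.bypass_adj]
        grind
      · exact hST.mono_right (Finset.erase_subset _ _)
      · intro x hx y hy hxy
        rw [SimpleGraph.bypass_adj] at hxy
        have := hH x hx w hw
        have := hH x hx y (Finset.mem_of_mem_erase hy)
        tauto
      · have := Finset.card_erase_of_mem (Finset.mem_union_right S hw)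
        rw [Finset.erase_union_distrib, Finset.erase_eq_of_notMem hwS] at this
        omega
    rw [Finset.sum_union hST, Finset.sum_congr rfl h1, Finset.sum_congr rfl h2, ← Finset.sum_mul,
      ← Finset.mul_sum, freedom_union hST hH]
    have h3 := freedom_mul_pathWeight h S c
    have h4 := freedom_mul_pathWeight h T c
    by_cases hS : ProperOn H S c <;> by_cases hT : ProperOn H T c <;>
      simp only [hproper, hS, hT, and_true, and_false, if_true, if_false] at h3 h4 ⊢
    · rw [← h3, ← h4]
      ring
    · rw [pathWeight_eq_zero hT]; ring
    · rw [pathWeight_eq_zero hS]; ring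
    · rw [pathWeight_eq_zero hS]; ring

section Marginal

variable {α : Type*} [Fintype α]

/-- The sum of `f` over all values of the coordinates in `T`. -/
noncomputable def marginal (T : Finset V) (f : (V → α) → ℝ) (c : V → α) : ℝ :=
  ∑ y : T → α, f (updateFinset c T y)

theorem marginal_empty (f : (V → α) → ℝ) (c : V → α) : marginal ∅ f c = f c := by
  simp [marginal]

theorem marginal_insert {T : Finset V} {v : V} (hv : v ∉ T) (f : (V → α) → ℝ) (c : V → α) :
    marginal (insert v T) f c = marginal T (fun c' => ∑ a, f (update c' v a)) c := by
  simp only [marginal]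
  rw [← Fintype.sum_prod_type']
  refine Fintype.sum_bijective (fun y => (fun x => y ⟨x, Finset.mem_insert_of_mem x.2⟩,
    y ⟨v, Finset.mem_insert_self v T⟩)) ⟨fun y z hyz => ?_, fun y => ?_⟩ _ _ fun y => ?_
  · ext ⟨x, hx⟩
    rw [Prod.mk.injEq] at hyz
    rcases Finset.mem_insert.1 hx with rfl | hx'
    · exact hyz.2
    · exact congrFun hyz.1 ⟨x, hx'⟩
  · refine ⟨fun x => if h : x.1 ∈ T then y.1 ⟨x, h⟩ else y.2, ?_⟩
    simp [hv]
  · congr 1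
    ext x
    by_cases hx : x = v
    · subst hx
      simp [updateFinset_def]
    · simp [updateFinset_def, hx]

theorem marginal_sum_update {T : Finset V} {v : V} (hv : v ∉ T) (f : (V → α) → ℝ) (c : V → α) :
    marginal T (fun c' => ∑ a, f (update c' v a)) c = ∑ a, marginal T f (update c v a) := by
  simp only [marginal]
  rw [Finset.sum_comm]
  refine Finset.sum_congr rfl fun a _ => Finset.sum_congr rfl fun y _ => ?_
  congr 1
  ext x
  by_cases hx : x = v
  · subst hx
    simp [updateFinset_def, hv]
  · simp [updateFinset_def, hx]

theorem marginal_mul {T U : Finset V} (hTU : Disjoint T U) {f g : (V → α) → ℝ}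
    (hf : ∀ v ∈ U, ∀ c a, f (update c v a) = f c) (hg : ∀ v ∈ T, ∀ c a, g (update c v a) = g c)
    (c : V → α) : marginal (T ∪ U) (fun c => f c * g c) c = marginal T f c * marginal U g c := by
  induction T using Finset.induction_on generalizing f with
  | empty =>
    rw [Finset.empty_union, marginal_empty]
    induction U using Finset.induction_on generalizing g with
    | empty => simp [marginal_empty]
    | insert v U hv ih =>
      rw [marginal_insert hv, marginal_insert hv, ← ih (by simp)
        (fun u hu => hf u (Finset.mem_insert_of_mem hu)) (by simp)]
      congr 1
      ext c
      rw [Finset.mul_sum]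
      exact Finset.sum_congr rfl fun a _ => by rw [hf v (Finset.mem_insert_self _ _)]
  | insert v T hv ih =>
    have hvU : v ∉ U := Finset.disjoint_left.1 hTU (Finset.mem_insert_self _ _)
    rw [marginal_insert hv, Finset.insert_union, marginal_insert (by simp [hv, hvU]), ← ih
      (hTU.mono_left (Finset.subset_insert _ _)) _
      (fun u hu => hg u (Finset.mem_insert_of_mem hu))]
    · congr 1
      ext c
      rw [Finset.sum_mul]
      exact Finset.sum_congr rfl fun a _ => by rw [hg v (Finset.mem_insert_self _ _)]
    · intro u hu c a
      refine Finset.sum_congr rfl fun b _ => ?_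
      have : u ≠ v := by rintro rfl; exact hvU hu
      rw [update_comm this, hf u hu]

theorem marginal_map (ι : V' ↪ V) (T : Finset V') {f : (V → α) → ℝ} {f' : (V' → α) → ℝ}
    (hf : ∀ c, f c = f' (c ∘ ι)) (c : V → α) :
    marginal (T.map ι) f c = marginal T f' (c ∘ ι) := by
  induction T using Finset.induction_on generalizing f f' with
  | empty => rw [Finset.map_empty, marginal_empty, marginal_empty, hf]
  | insert v T hv ih =>
    rw [Finset.map_insert, marginal_insert (by simpa using hv), marginal_insert hv]
    refine ih fun c => Finset.sum_congr rfl fun a _ => ?_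
    rw [hf, update_comp_eq_of_injective _ ι.injective]

end Marginal

/-! ### Locality of the marginals of the path coloring -/

/-- The probability that the restriction to `F` of the random coloring of the subgraph of `H`
induced by `W` is `c`. -/
noncomputable def localWeight (H : SimpleGraph V) (W F : Finset V) (c : V → Fin 3) : ℝ :=
  marginal (W \ F) (pathWeight H W) c

theorem localWeight_nonneg {H : SimpleGraph V} (h : H.DegreeLETwo) (W F : Finset V)
    (c : V → Fin 3) : 0 ≤ localWeight H W F c :=
  Finset.sum_nonneg fun _ _ => pathWeight_nonneg h _ _

theorem localWeight_congr {H H' : SimpleGraph V} {W F : Finset V} {c c' : V → Fin 3}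
    (hH : ∀ x ∈ W, ∀ y ∈ W, H'.Adj x y ↔ H.Adj x y) (hc : ∀ x ∈ F, c' x = c x) :
    localWeight H' W F c' = localWeight H W F c := by
  refine Finset.sum_congr rfl fun y _ => pathWeight_congr hH fun x hx => ?_
  by_cases hxF : x ∈ F
  · simp [updateFinset_def, hxF, hc x hxF]
  · simp [updateFinset_def, hx, hxF]

theorem localWeight_eq_zero {H : SimpleGraph V} {W F : Finset V} (hF : F ⊆ W) {c : V → Fin 3}
    {u v : V} (hu : u ∈ F) (hv : v ∈ F) (huv : H.Adj u v) (hc : c u = c v) :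
    localWeight H W F c = 0 := by
  refine Finset.sum_eq_zero fun y _ => pathWeight_eq_zero fun hp => ?_
  refine hp u (hF hu) v (hF hv) huv ?_
  simpa [updateFinset_def, hu, hv] using hc

theorem sum_localWeight_update {H : SimpleGraph V} {W F : Finset V} {v : V} (hvW : v ∈ W)
    (hvF : v ∉ F) (c : V → Fin 3) :
    ∑ a, localWeight H W (insert v F) (update c v a) = localWeight H W F c := by
  have : W \ F = insert v (W \ insert v F) := by
    ext x
    simp only [Finset.mem_sdiff, Finset.mem_insert]
    grind
  rw [localWeight, this, marginal_insert (by simp), marginal_sum_update (by simp)]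
  rfl

/-- With the edge, summing over the colors of its ends deletes both at once; without it, each end
has at most one neighbor left and is deleted on its own. The same weight remains. -/
theorem localWeight_deleteEdge {H : SimpleGraph V} (h : H.DegreeLETwo) {W F : Finset V} {u v : V}
    (hu : u ∈ W \ F) (hv : v ∈ W \ F) (c : V → Fin 3) :
    localWeight (H.deleteEdges {s(u, v)}) W F c = localWeight H W F c := by
  by_cases huv : H.Adj u v
  swap
  · rw [SimpleGraph.deleteEdges_eq_self.2]
    simpa using huv
  have hne := huv.ne
  have hu1 := (Finset.mem_sdiff.1 hu).1
  have hv1 := (Finset.mem_sdiff.1 hv).1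
  have hadj : ∀ x y, (H.deleteEdges {s(u, v)}).Adj x y ↔
      H.Adj x y ∧ ¬ (x = u ∧ y = v) ∧ ¬ (x = v ∧ y = u) := by
    intro x y
    rw [SimpleGraph.deleteEdges_adj, Set.mem_singleton_iff, Sym2.eq_iff]
    tauto
  have h' : (H.deleteEdges {s(u, v)}).DegreeLETwo := fun x a b c ha hb hc =>
    h x a b c ((hadj _ _).1 ha).1 ((hadj _ _).1 hb).1 ((hadj _ _).1 hc).1
  have hT : W \ F = insert v (insert u (((W \ F).erase v).erase u)) := by
    rw [Finset.insert_erase (Finset.mem_erase.2 ⟨hne, hu⟩), Finset.insert_erase hv]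
  rw [localWeight, localWeight, hT]
  have hn1 : v ∉ insert u (((W \ F).erase v).erase u) := by simp [hne.symm]
  have hn2 : u ∉ ((W \ F).erase v).erase u := by simp
  rw [marginal_insert hn1, marginal_insert hn2, marginal_insert hn1, marginal_insert hn2]
  congr 1
  ext c
  rw [sum_sum_pathWeight_update h hu1 hv1 huv]
  have hv2 : v ∈ W.erase u := Finset.mem_erase.2 ⟨hne.symm, hv1⟩
  rw [Finset.sum_congr rfl fun a _ => sum_pathWeight_update h' hv1 (fun x hx y hy hvx hvy => ?_) _]
  · rw [sum_pathWeight_update h' (Finset.mem_erase.2 ⟨hne, hu1⟩) fun x hx y hy hux huy => ?_]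
    · rw [Finset.erase_right_comm]
      refine pathWeight_congr (fun x hx y hy => ?_) fun _ _ => rfl
      simp only [Finset.mem_erase] at hx hy
      rw [hadj]
      tauto
    · rw [hadj] at hux huy
      have := h u v x y huv hux.1 huy.1
      grind
  · rw [hadj] at hvx hvy
    have := h v u x y huv.symm hvx.1 hvy.1
    grind

/-- Edges with no end in `F` are irrelevant for the coloring of `F`. -/
theorem localWeight_deleteEdges {H : SimpleGraph V} (h : H.DegreeLETwo) {W F : Finset V}
    (c : V → Fin 3) (E : Finset (Sym2 V)) (hE : E ⊆ (W \ F).sym2) :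
    localWeight (H.deleteEdges E) W F c = localWeight H W F c := by
  induction E using Finset.induction_on with
  | empty => simp
  | insert e E he ih =>
    rw [Finset.insert_subset_iff] at hE
    have h' : (H.deleteEdges E).DegreeLETwo := fun x a b c ha hb hc =>
      h x a b c (SimpleGraph.deleteEdges_le _ ha) (SimpleGraph.deleteEdges_le _ hb)
        (SimpleGraph.deleteEdges_le _ hc)
    rw [← ih hE.2]
    induction e with
    | _ u v =>
    rw [Finset.mk_mem_sym2_iff] at hE
    rw [← localWeight_deleteEdge h' hE.1.1 hE.1.2, SimpleGraph.deleteEdges_deleteEdges,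
      Finset.coe_insert, Set.union_singleton]

theorem localWeight_eq_of_adj_iff {H H' : SimpleGraph V} (h : H.DegreeLETwo)
    (h' : H'.DegreeLETwo) {W F : Finset V} (hH : ∀ x ∈ F, ∀ y ∈ W, H.Adj x y ↔ H'.Adj x y)
    (c : V → Fin 3) : localWeight H W F c = localWeight H' W F c := by
  rw [← localWeight_deleteEdges h c _ subset_rfl, ← localWeight_deleteEdges h' c _ subset_rfl]
  refine localWeight_congr (fun x hx y hy => ?_) fun _ _ => rfl
  have h1 := H.adj_comm x y
  have h2 := H'.adj_comm x y
  have h3 := hH x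
  have h4 := hH y
  simp only [SimpleGraph.deleteEdges_adj, Finset.mem_coe, Finset.mk_mem_sym2_iff,
    Finset.mem_sdiff]
  grind

/-- A vertex outside `W` has no neighbor in `F`. Once the edges with no end in `F` are erased it is
isolated, and summing over its color removes it. -/
theorem localWeight_subset {H : SimpleGraph V} (h : H.DegreeLETwo) {W W' F : Finset V}
    (hF : F ⊆ W) (hW : W ⊆ W') (hH : ∀ x ∈ F, ∀ y ∈ W', H.Adj x y → y ∈ W)
    (c : V → Fin 3) : localWeight H W' F c = localWeight H W F c := by
  induction hn : (W' \ W).card generalizing W' with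
  | zero =>
    rw [hW.antisymm (Finset.sdiff_eq_empty_iff_subset.1 (Finset.card_eq_zero.1 hn))]
  | succ n ih =>
    obtain ⟨z, hz⟩ : (W' \ W).Nonempty := Finset.card_pos.1 (by omega)
    obtain ⟨hz1, hz2⟩ := Finset.mem_sdiff.1 hz
    have hzF : z ∉ F := fun hzF => hz2 (hF hzF)
    rw [← ih (W' := W'.erase z) (Finset.subset_erase.2 ⟨hW, hz2⟩)
      (fun x hx y hy => hH x hx y (Finset.mem_of_mem_erase hy))]
    swap
    · rw [Finset.erase_sdiff_comm, Finset.card_erase_of_mem hz]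
      omega
    set H₀ := H.deleteEdges ((W' \ F).sym2 : Set (Sym2 V)) with hH₀
    have h₀ : H₀.DegreeLETwo := fun x a b c ha hb hc =>
      h x a b c (SimpleGraph.deleteEdges_le _ ha) (SimpleGraph.deleteEdges_le _ hb)
        (SimpleGraph.deleteEdges_le _ hc)
    have hadj : ∀ x ∈ F, ∀ y, H.Adj x y ↔ H₀.Adj x y := by
      intro x hx y
      simp [hH₀, SimpleGraph.deleteEdges_adj, hx]
    rw [localWeight_eq_of_adj_iff h h₀ fun x hx y _ => hadj x hx y,
      localWeight_eq_of_adj_iff h h₀ (W := W'.erase z) fun x hx y _ => hadj x hx y]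
    have hT : W' \ F = insert z (W'.erase z \ F) := by
      rw [Finset.erase_sdiff_comm, Finset.insert_erase (Finset.mem_sdiff.2 ⟨hz1, hzF⟩)]
    rw [localWeight, localWeight, hT, marginal_insert (by simp)]
    congr 1
    ext c
    refine sum_pathWeight_update h₀ hz1 (fun x hx y hy hzx hzy => ?_) c
    exfalso
    simp only [hH₀, SimpleGraph.deleteEdges_adj, Finset.mem_coe, Finset.mk_mem_sym2_iff,
      Finset.mem_sdiff, hz1, hzF, hx, true_and, not_false_eq_true, not_not] at hzx
    exact hz2 (hH x hzx.2 z hz1 hzx.1.symm)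

/-- The coloring of `F` only depends on the edges with an end in `F`. -/
theorem localWeight_eq {H H' : SimpleGraph V} (h : H.DegreeLETwo) (h' : H'.DegreeLETwo)
    {W W' F : Finset V} (hW : F ⊆ W) (hW' : F ⊆ W') (hH : ∀ x ∈ F, ∀ y, H.Adj x y ↔ H'.Adj x y)
    (hHW : ∀ x ∈ F, ∀ y, H.Adj x y → y ∈ W ∧ y ∈ W') (c : V → Fin 3) :
    localWeight H W F c = localWeight H' W' F c := by
  rw [← localWeight_subset h hW (Finset.subset_union_left (s₂ := W'))
      fun x hx y _ hxy => (hHW x hx y hxy).1,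
    ← localWeight_subset h' hW' (Finset.subset_union_right (s₁ := W))
      fun x hx y _ hxy => (hHW x hx y ((hH x hx y).2 hxy)).2]
  exact localWeight_eq_of_adj_iff h h' (fun x hx y _ => hH x hx y) c

theorem localWeight_map (ι : V' ↪ V) {H' : SimpleGraph V'} {H : SimpleGraph V}
    (h' : H'.DegreeLETwo) (h : H.DegreeLETwo) {W' F : Finset V'} {W : Finset V} (hW' : F ⊆ W')
    (hW : F.map ι ⊆ W) (hH : ∀ x ∈ F, ∀ y, H.Adj (ι x) y ↔ ∃ y', ι y' = y ∧ H'.Adj x y')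
    (hHW : ∀ x ∈ F, ∀ y, H'.Adj x y → y ∈ W' ∧ ι y ∈ W) {c' : V' → Fin 3} {c : V → Fin 3}
    (hc : ∀ x ∈ F, c' x = c (ι x)) :
    localWeight H' W' F c' = localWeight H W (F.map ι) c := by
  -- `ι` respects adjacency only near `F`. It does so everywhere for the pulled-back graph, which
  -- may replace `H'` because edges away from `F` are irrelevant.
  have h'' : (H.comap ι).DegreeLETwo := fun x a b c ha hb hc => by
    simpa using h (ι x) (ι a) (ι b) (ι c) ha hb hc
  have hadj : ∀ x ∈ F, ∀ y, H'.Adj x y ↔ (H.comap ι).Adj x y := by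
    intro x hx y
    rw [SimpleGraph.comap_adj, hH x hx]
    simp
  rw [localWeight_eq h' h'' hW' hW' hadj
    (fun x hx y hxy => ⟨(hHW x hx y hxy).1, (hHW x hx y hxy).1⟩)]
  rw [localWeight_congr (c := c ∘ ι) (fun _ _ _ _ => Iff.rfl) hc]
  rw [← localWeight_eq h h (W := W'.map ι) (Finset.map_subset_map.2 hW') hW
    (fun _ _ _ => Iff.rfl)]
  · rw [localWeight, localWeight, ← Finset.map_sdiff]
    exact (marginal_map ι _ (fun c => (pathWeight_map ι (fun _ _ _ _ => Iff.rfl)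
      fun _ _ => rfl).symm) c).symm
  · simp only [Finset.forall_mem_map]
    intro x hx y hxy
    obtain ⟨y', rfl, hy'⟩ := (hH x hx y).1 hxy
    have := hHW x hx y' hy'
    simpa using this

/-- Once the edges with no end in `A ∪ B` are erased, none joins `W` to `W'`: edges from `A` stay in
`W` and edges from `B` stay in `W'`. Then `pathWeight_union` applies. -/
theorem localWeight_union {H : SimpleGraph V} (h : H.DegreeLETwo) {A B W W' : Finset V}
    (hA : A ⊆ W) (hB : B ⊆ W') (hHA : ∀ x ∈ A, ∀ y, H.Adj x y → y ∈ W)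
    (hHB : ∀ x ∈ B, ∀ y, H.Adj x y → y ∈ W') (hWW' : Disjoint W W') (c : V → Fin 3) :
    localWeight H (W ∪ W') (A ∪ B) c = localWeight H W A c * localWeight H W' B c := by
  set E : Finset (Sym2 V) := ((W ∪ W') \ (A ∪ B)).sym2 with hE
  set H₀ := H.deleteEdges (E : Set (Sym2 V)) with hH₀
  have h₀ : H₀.DegreeLETwo := fun x a b c ha hb hc =>
      h x a b c (SimpleGraph.deleteEdges_le _ ha) (SimpleGraph.deleteEdges_le _ hb)
        (SimpleGraph.deleteEdges_le _ hc)
  have hadj : ∀ x ∈ A ∪ B, ∀ y, H.Adj x y ↔ H₀.Adj x y := by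
    intro x hx y
    simp only [hH₀, SimpleGraph.deleteEdges_adj, hE, Finset.mem_coe, Finset.mk_mem_sym2_iff,
      Finset.mem_sdiff]
    tauto
  rw [localWeight_eq_of_adj_iff h h₀ fun x hx y _ => hadj x hx y,
    localWeight_eq_of_adj_iff h h₀ (F := A) fun x hx y _ => hadj x (Finset.mem_union_left _ hx) y,
    localWeight_eq_of_adj_iff h h₀ (F := B) fun x hx y _ => hadj x (Finset.mem_union_right _ hx) y]
  have hdis := Finset.disjoint_left.1 hWW'
  have hno : ∀ x ∈ W, ∀ y ∈ W', ¬ H₀.Adj x y := by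
    intro x hx y hy hxy
    simp only [hH₀, SimpleGraph.deleteEdges_adj, hE, Finset.mem_coe, Finset.mk_mem_sym2_iff,
      Finset.mem_sdiff, Finset.mem_union, hx, hy] at hxy
    have h1 := hHA x
    have h2 := hHB y
    have h3 := @hA y
    have h4 := @hB x
    have h5 := hxy.1.symm
    have h6 := @hdis x
    have h7 := @hdis y
    grind
  have hS : (W ∪ W') \ (A ∪ B) = (W \ A) ∪ (W' \ B) := by
    ext x
    have h3 := @hA x
    have h4 := @hB x
    have h6 := @hdis x
    simp only [Finset.mem_sdiff, Finset.mem_union]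
    grind
  rw [localWeight, localWeight, localWeight, hS, ← marginal_mul]
  · congr 1
    ext c
    exact pathWeight_union h₀ hWW' hno c
  · exact hWW'.mono Finset.sdiff_subset Finset.sdiff_subset
  · intro v hv c a
    refine pathWeight_congr (fun _ _ _ _ => Iff.rfl) fun x hx => update_of_ne ?_ _ _
    rintro rfl
    exact hdis hx (Finset.sdiff_subset hv)
  · intro v hv c a
    refine pathWeight_congr (fun _ _ _ _ => Iff.rfl) fun x hx => update_of_ne ?_ _ _
    rintro rfl
    exact hdis (Finset.sdiff_subset hv) hx

theorem localWeight_empty {H : SimpleGraph V} (h : H.DegreeLETwo) (W : Finset V)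
    (c : V → Fin 3) : localWeight H W ∅ c = 1 := by
  rw [localWeight_subset h subset_rfl (Finset.empty_subset W) (by simp)]
  simp [localWeight, marginal_empty, pathWeight_empty]

end PathColoring

/-! ### Kolmogorov extension for finitely many states -/

section KolmogorovExtension

open scoped Classical
open Function

variable {V C : Type*} [Fintype C]

theorem cylinderWeight_eq_marginal {m : Finset V → (V → C) → ℝ}
    (hsum : ∀ F, ∀ v ∉ F, ∀ c, ∑ a, m (insert v F) (update c v a) = m F c) {F T : Finset V}
    (hFT : Disjoint F T) (c : V → C) : m F c = marginal T (m (F ∪ T)) c := by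
  induction T using Finset.induction_on generalizing c with
  | empty => rw [Finset.union_empty, marginal_empty]
  | insert v T hv ih =>
    rw [Finset.disjoint_insert_right] at hFT
    rw [marginal_insert hv, ih hFT.2]
    congr 1
    ext c
    rw [Finset.union_insert, hsum]
    simp [hv, hFT.1]

theorem measurableCylinder_isClopen {X : Type*} [TopologicalSpace X] [DiscreteTopology X]
    [MeasurableSpace X] {s : Set (V → X)} (hs : s ∈ measurableCylinders fun _ : V => X) :
    IsClopen s := by
  obtain ⟨I, S, _, rfl⟩ := (mem_measurableCylinders _).1 hs
  exact (isClopen_discrete S).preimage (by fun_prop)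

/-- The Kolmogorov extension theorem for processes with finitely many states. -/
theorem exists_measure_of_cylinderWeight [MeasurableSpace C] [MeasurableSingletonClass C] [Nonempty C]
    {m : Finset V → (V → C) → ℝ} (hnonneg : ∀ F c, 0 ≤ m F c)
    (hcongr : ∀ F c c', (∀ x ∈ F, c x = c' x) → m F c = m F c') (hempty : ∀ c, m ∅ c = 1)
    (hsum : ∀ F, ∀ v ∉ F, ∀ c, ∑ a, m (insert v F) (update c v a) = m F c) :
    ∃ P : Measure (V → C), IsProbabilityMeasure P ∧
      ∀ F c, P {c' | ∀ x ∈ F, c' x = c x} = ENNReal.ofReal (m F c) := by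
  let c₀ : V → C := fun _ => Classical.arbitrary C
  let Q : ∀ F : Finset V, Measure (F → C) := fun F =>
    ∑ y : F → C, ENNReal.ofReal (m F (updateFinset c₀ F y)) • Measure.dirac y
  have hQ : ∀ (F : Finset V) (s : Set (F → C)), Q F s =
      ∑ y : F → C, if y ∈ s then ENNReal.ofReal (m F (updateFinset c₀ F y)) else 0 := by
    intro F s
    simp only [Q, Measure.finsetSum_apply, Measure.smul_apply, smul_eq_mul]
    refine Finset.sum_congr rfl fun y _ => ?_
    rw [Measure.dirac_apply]
    by_cases h : y ∈ s <;> simp [h]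
  have hQproj : IsProjectiveMeasureFamily (α := fun _ => C) Q := by
    intro I J hJI
    refine Measure.ext_of_singleton fun y => ?_
    rw [Measure.map_apply (measurable_of_countable _) (measurableSet_singleton y), hQ, hQ]
    simp only [Set.mem_singleton_iff, Finset.sum_ite_eq', Finset.mem_univ, if_true,
      Set.mem_preimage]
    rw [← Finset.sum_filter, ← ENNReal.ofReal_sum_of_nonneg fun _ _ => hnonneg _ _]
    congr 1
    rw [cylinderWeight_eq_marginal hsum (Finset.disjoint_sdiff (s := J) (t := I)), marginal,
      Finset.union_sdiff_of_subset hJI]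
    refine Finset.sum_bij'
      (fun t _ => fun x : I => updateFinset (updateFinset c₀ J y) (I \ J) t x)
      (fun z _ => fun x : (I \ J : Finset V) => z ⟨x.1, Finset.sdiff_subset x.2⟩) ?_ ?_ ?_ ?_ ?_
    · intro t _
      simp only [Finset.mem_filter, Finset.mem_univ, true_and]
      ext x
      simp [updateFinset_def]
    · simp
    · intro t _
      ext x
      simp [updateFinset_def]
    · intro z hz
      simp only [Finset.mem_filter, Finset.mem_univ, true_and] at hz
      ext x
      by_cases hx : x.1 ∈ J
      · simp only [updateFinset_def, Finset.mem_sdiff, hx, not_true, and_false, dite_false,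
          dite_true]
        exact (congrFun hz ⟨x.1, hx⟩).symm
      · simp [updateFinset_def, hx]
    · intro t _
      refine hcongr _ _ _ fun x hx => ?_
      by_cases hxJ : x ∈ J <;> simp [updateFinset_def, hx, hxJ]
  let : TopologicalSpace C := ⊥
  have : DiscreteTopology C := ⟨rfl⟩
  -- Cylinders are clopen in the compact space `V → C`, so a countable cover of a cylinder by
  -- cylinders has a finite subcover and finite subadditivity suffices.
  have hsub : (projectiveFamilyContent hQproj).IsSigmaSubadditive := by
    intro f hf hfU
    have hcpt : IsCompact (⋃ i, f i) := (measurableCylinder_isClopen hfU).isClosed.isCompact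
    obtain ⟨t, ht⟩ := hcpt.elim_finite_subcover f
      (fun i => (measurableCylinder_isClopen (hf i)).isOpen) subset_rfl
    calc projectiveFamilyContent hQproj (⋃ i, f i)
        ≤ projectiveFamilyContent hQproj (⋃ i ∈ t, f i) :=
          addContent_mono isSetSemiring_measurableCylinders hfU
            (isSetRing_measurableCylinders.biUnion_mem t fun i _ => hf i) ht
      _ ≤ ∑ i ∈ t, projectiveFamilyContent hQproj (f i) :=
          addContent_biUnion_le isSetRing_measurableCylinders fun i _ => hf i
      _ ≤ ∑' i, projectiveFamilyContent hQproj (f i) := ENNReal.sum_le_tsum t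
  refine ⟨(projectiveFamilyContent hQproj).measure isSetSemiring_measurableCylinders
    generateFrom_measurableCylinders.ge hsub, ?_⟩
  have hcyl : ∀ (F : Finset V) (s : Set (F → C)),
      (projectiveFamilyContent hQproj).measure isSetSemiring_measurableCylinders
        generateFrom_measurableCylinders.ge hsub (cylinder F s) = Q F s := by
    intro F s
    have hs : MeasurableSet s := (Set.toFinite s).measurableSet
    exact (AddContent.measure_eq _ isSetSemiring_measurableCylinders
      generateFrom_measurableCylinders.symm hsub
      (cylinder_mem_measurableCylinders (α := fun _ : V => C) F s hs)).trans
      (projectiveFamilyContent_cylinder hQproj hs)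
  constructor
  · constructor
    rw [← cylinder_univ (∅ : Finset V), hcyl, hQ]
    simp [hempty]
  · intro F c
    have : {c' : V → C | ∀ x ∈ F, c' x = c x} =
        cylinder (α := fun _ => C) F {fun x : F => c x} := by
      ext c'
      simp [cylinder, funext_iff]
    rw [this, hcyl, hQ]
    simp only [Set.mem_singleton_iff, Finset.sum_ite_eq', Finset.mem_univ, if_true]
    congr 1
    refine hcongr _ _ _ fun x hx => ?_
    simp [updateFinset_def, hx]

end KolmogorovExtension

/-! ### Random labels and the finite marginals of the coloring -/

section Labels

open scoped Classical
open Function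

/-- Partial labelings of `N` by `Fin d` without repetitions, which are total if `N` has at most
`d` elements. -/
def Labeling (N : Type*) (d : ℕ) : Type _ :=
  {f : N → Option (Fin d) // (∀ x y i, f x = some i → f y = some i → x = y) ∧
    (Nat.card N ≤ d → ∀ x, (f x).isSome)}

namespace Labeling

variable {N N' : Type*} {d : ℕ}

instance : MeasurableSpace (Labeling N d) := ⊤

instance : DiscreteMeasurableSpace (Labeling N d) := ⟨fun _ => trivial⟩

instance [Finite N] : Finite (Labeling N d) := Subtype.finite

/-- Allowing partial labelings keeps this type inhabited for more than `d` neighbors, so that the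
coloring law exists on every locally finite graph. Totality matters only for properness. -/
instance [Finite N] : Nonempty (Labeling N d) := by
  by_cases h : Nat.card N ≤ d
  · have := Fintype.ofFinite N
    rw [Nat.card_eq_fintype_card] at h
    obtain ⟨g⟩ : Nonempty (N ↪ Fin d) := Embedding.nonempty_of_card_le (by simpa using h)
    exact ⟨⟨fun x => some (g x), fun x y i hx hy => g.injective
      (Option.some_injective _ (hx.trans hy.symm)), fun _ _ => rfl⟩⟩
  · exact ⟨⟨fun _ => none, fun x y i hx => by simp at hx, fun h' => absurd h' h⟩⟩

/-- Labelings of equivalent types. -/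
def pull (e : N' ≃ N) : Labeling N d ≃ Labeling N' d where
  toFun f := ⟨fun x => f.1 (e x), fun x y i hx hy => e.injective (f.2.1 _ _ i hx hy),
    fun h x => f.2.2 (by rwa [← Nat.card_congr e]) _⟩
  invFun f := ⟨fun x => f.1 (e.symm x), fun x y i hx hy => e.symm.injective (f.2.1 _ _ i hx hy),
    fun h x => f.2.2 (by rwa [Nat.card_congr e]) _⟩
  left_inv f := Subtype.ext (funext fun x => by simp)
  right_inv f := Subtype.ext (funext fun x => by simp)

end Labeling

theorem map_uniformOn_univ {α β : Type*} [MeasurableSpace α] [MeasurableSpace β]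
    [DiscreteMeasurableSpace α] [DiscreteMeasurableSpace β] [Finite α] (e : α ≃ β) :
    (uniformOn (Set.univ : Set α)).map e = uniformOn (Set.univ : Set β) := by
  have := Fintype.ofFinite α
  have := Fintype.ofEquiv α e
  refine Measure.ext_of_singleton fun b => ?_
  rw [Measure.map_apply (measurable_of_countable _) (measurableSet_singleton b), uniformOn_univ,
    uniformOn_univ, Fintype.card_congr e]
  congr 1
  have : e ⁻¹' {b} = {e.symm b} := by
    ext x
    simp [Equiv.eq_symm_apply]
  rw [this, Measure.count_singleton, Measure.count_singleton]

variable {V V' : Type*} {d : ℕ}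

/-- The edges of `G` which bear the unordered pair of labels `e` at their ends. -/
def labelGraph (G : SimpleGraph V) (ℓ : ∀ v, Labeling (G.neighborSet v) d) (e : Sym2 (Fin d)) :
    SimpleGraph V where
  Adj x y := ∃ h : G.Adj x y, ∃ i j, (ℓ x).1 ⟨y, h⟩ = some i ∧ (ℓ y).1 ⟨x, h.symm⟩ = some j ∧
    s(i, j) = e
  symm := ⟨fun _ _ ⟨h, i, j, hi, hj, he⟩ => ⟨h.symm, j, i, hj, hi, Sym2.eq_swap.trans he⟩⟩
  loopless := ⟨fun x ⟨h, _⟩ => G.loopless.irrefl x h⟩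

/-- At `x` an edge of the pair s(i, j) bears the label i or j, and each label is used for at most
one neighbor. -/
theorem labelGraph_degreeLETwo (G : SimpleGraph V) (ℓ : ∀ v, Labeling (G.neighborSet v) d)
    (e : Sym2 (Fin d)) : (labelGraph G ℓ e).DegreeLETwo := by
  rintro x a b c ⟨ha, i, i', hi, -, rfl⟩ ⟨hb, j, j', hj, -, hje⟩ ⟨hc, k, k', hk, -, hke⟩
  rw [Sym2.eq_iff] at hje hke
  have h1 := (ℓ x).2.1 ⟨a, ha⟩ ⟨b, hb⟩
  have h2 := (ℓ x).2.1 ⟨a, ha⟩ ⟨c, hc⟩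
  have h3 := (ℓ x).2.1 ⟨b, hb⟩ ⟨c, hc⟩
  by_cases hij : j = i
  · exact Or.inl (congrArg Subtype.val (h1 i hi (hij ▸ hj)))
  by_cases hik : k = i
  · exact Or.inr (Or.inl (congrArg Subtype.val (h2 i hi (hik ▸ hk))))
  have : j = k := by grind
  exact Or.inr (Or.inr (congrArg Subtype.val (h3 j hj (this ▸ hk))))

theorem labelGraph_adj_congr {G : SimpleGraph V} {ℓ ℓ' : ∀ v, Labeling (G.neighborSet v) d}
    {e : Sym2 (Fin d)} {x y : V} (hx : ℓ x = ℓ' x) (hy : G.Adj x y → ℓ y = ℓ' y) :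
    (labelGraph G ℓ e).Adj x y ↔ (labelGraph G ℓ' e).Adj x y := by
  refine exists_congr fun h => ?_
  rw [hx, hy h]

/-- The vertices of `F` and their neighbors. -/
noncomputable def closedNbhd (G : SimpleGraph V) [∀ v, Finite (G.neighborSet v)]
    (F : Finset V) : Finset V :=
  F ∪ F.biUnion fun v => (Set.toFinite (G.neighborSet v)).toFinset

theorem mem_closedNbhd {G : SimpleGraph V} [∀ v, Finite (G.neighborSet v)] {F : Finset V} {y : V} :
    y ∈ closedNbhd G F ↔ y ∈ F ∨ ∃ x ∈ F, G.Adj x y := by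
  simp [closedNbhd]

theorem subset_closedNbhd (G : SimpleGraph V) [∀ v, Finite (G.neighborSet v)] (F : Finset V) :
    F ⊆ closedNbhd G F := Finset.subset_union_left

theorem card_sym2_fun_fin (d : ℕ) :
    Fintype.card (Sym2 (Fin d) → Fin 3) = 3 ^ (d * (d + 1) / 2) := by
  rw [Fintype.card_fun, Sym2.card, Fintype.card_fin, Fintype.card_fin, Nat.choose_two_right,
    Nat.add_sub_cancel, mul_comm]

/-- The color of the vertices for the graph of label `e`. -/
noncomputable def colorComponent (c : V → Fin (3 ^ (d * (d + 1) / 2))) (e : Sym2 (Fin d)) (v : V) :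
    Fin 3 :=
  (Fintype.equivFinOfCardEq (card_sym2_fun_fin d)).symm (c v) e

/-- The probability that the coloring of `F` is `c`, given the labels. -/
noncomputable def labeledWeight (G : SimpleGraph V) [∀ v, Finite (G.neighborSet v)]
    (F : Finset V) (c : V → Fin (3 ^ (d * (d + 1) / 2)))
    (ℓ : ∀ v, Labeling (G.neighborSet v) d) : ℝ :=
  ∏ e, localWeight (labelGraph G ℓ e) (closedNbhd G F) F (colorComponent c e)

/-- The law of independent uniformly random labelings of the neighborhoods of the vertices. -/
noncomputable def labelLaw (G : SimpleGraph V) (d : ℕ) :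
    Measure (∀ v, Labeling (G.neighborSet v) d) :=
  Measure.infinitePi fun _ => uniformOn Set.univ

instance (G : SimpleGraph V) [∀ v, Finite (G.neighborSet v)] :
    IsProbabilityMeasure (labelLaw G d) := by
  unfold labelLaw
  infer_instance

/-- The probability that the coloring of `F` is `c`. -/
noncomputable def coloringWeight (G : SimpleGraph V) [∀ v, Finite (G.neighborSet v)]
    (F : Finset V) (c : V → Fin (3 ^ (d * (d + 1) / 2))) : ℝ :=
  ∫ ℓ, labeledWeight G F c ℓ ∂labelLaw G d

section

variable {G : SimpleGraph V} [∀ v, Finite (G.neighborSet v)]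

theorem labelGraph_adj_mem {ℓ : ∀ v, Labeling (G.neighborSet v) d} {e : Sym2 (Fin d)}
    {F : Finset V} {x y : V} (hx : x ∈ F) (h : (labelGraph G ℓ e).Adj x y) :
    y ∈ closedNbhd G F :=
  mem_closedNbhd.2 (Or.inr ⟨x, hx, h.1⟩)

theorem labeledWeight_nonneg (F : Finset V) (c : V → Fin (3 ^ (d * (d + 1) / 2)))
    (ℓ : ∀ v, Labeling (G.neighborSet v) d) : 0 ≤ labeledWeight G F c ℓ :=
  Finset.prod_nonneg fun _ _ => localWeight_nonneg (labelGraph_degreeLETwo G ℓ _) _ _ _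

/-- The weight involves only the edges meeting `F`. Both ends of such an edge are in the closed
neighborhood, and the labels at its ends decide its pair. -/
theorem labeledWeight_congr_label {F : Finset V} (c : V → Fin (3 ^ (d * (d + 1) / 2)))
    {ℓ ℓ' : ∀ v, Labeling (G.neighborSet v) d} (h : ∀ x ∈ closedNbhd G F, ℓ x = ℓ' x) :
    labeledWeight G F c ℓ = labeledWeight G F c ℓ' := by
  refine Finset.prod_congr rfl fun e _ => ?_
  refine localWeight_eq_of_adj_iff (labelGraph_degreeLETwo G ℓ _) (labelGraph_degreeLETwo G ℓ' _)
    (fun x hx y hy => ?_) _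
  exact labelGraph_adj_congr (h x (subset_closedNbhd G F hx)) fun _ => h y hy

/-- Factoring through finitely many labels, each with finitely many values, settles integrability,
measurability and independence below. -/
theorem exists_labeledWeight_eq_comp (F : Finset V) (c : V → Fin (3 ^ (d * (d + 1) / 2))) :
    ∃ g : (∀ v : closedNbhd G F, Labeling (G.neighborSet v) d) → ℝ,
      ∀ ℓ, labeledWeight G F c ℓ = g fun v => ℓ v := by
  have : DependsOn (labeledWeight G F c) (closedNbhd G F : Set V) := fun ℓ ℓ' h =>
    labeledWeight_congr_label c h
  obtain ⟨g, hg⟩ := dependsOn_iff_exists_comp.1 this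
  exact ⟨g, fun ℓ => congrFun hg ℓ⟩

theorem integrable_labeledWeight (F : Finset V) (c : V → Fin (3 ^ (d * (d + 1) / 2))) :
    Integrable (labeledWeight G F c) (labelLaw G d) := by
  obtain ⟨g, hg⟩ := exists_labeledWeight_eq_comp (G := G) F c
  rw [funext hg]
  have hm : Measurable fun (ℓ : ∀ v, Labeling (G.neighborSet v) d) (v : closedNbhd G F) => ℓ v := by
    fun_prop
  exact Integrable.comp_measurable (g := g) Integrable.of_finite hm

theorem coloringWeight_nonneg (F : Finset V) (c : V → Fin (3 ^ (d * (d + 1) / 2))) :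
    0 ≤ coloringWeight G F c :=
  integral_nonneg fun _ => labeledWeight_nonneg _ _ _

theorem coloringWeight_congr {F : Finset V} {c c' : V → Fin (3 ^ (d * (d + 1) / 2))}
    (h : ∀ x ∈ F, c x = c' x) : coloringWeight G F c = coloringWeight G F c' := by
  refine integral_congr_ae (ae_of_all _ fun ℓ => Finset.prod_congr rfl fun e _ =>
    localWeight_congr (fun _ _ _ _ => Iff.rfl) fun x hx => ?_)
  rw [colorComponent, colorComponent, h x hx]

theorem coloringWeight_empty (c : V → Fin (3 ^ (d * (d + 1) / 2))) :
    coloringWeight G ∅ c = 1 := by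
  have : ∀ ℓ, labeledWeight G ∅ c ℓ = 1 := fun ℓ =>
    Finset.prod_eq_one fun e _ => localWeight_empty (labelGraph_degreeLETwo G ℓ _) _ _
  simp [coloringWeight, this]

theorem sum_coloringWeight_update {F : Finset V} {v : V} (hv : v ∉ F)
    (c : V → Fin (3 ^ (d * (d + 1) / 2))) :
    ∑ a, coloringWeight G (insert v F) (update c v a) = coloringWeight G F c := by
  simp only [coloringWeight]
  rw [← integral_finsetSum _ fun a _ => integrable_labeledWeight _ _]
  congr 1
  ext ℓ
  have hvW : v ∈ closedNbhd G (insert v F) :=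
    subset_closedNbhd G _ (Finset.mem_insert_self _ _)
  -- The two sides are first expressed with the same window.
  have h1 : ∀ e c, localWeight (labelGraph G ℓ e) (closedNbhd G F) F c =
      localWeight (labelGraph G ℓ e) (closedNbhd G (insert v F)) F c := fun e c =>
    localWeight_eq (labelGraph_degreeLETwo G ℓ e) (labelGraph_degreeLETwo G ℓ e)
      (subset_closedNbhd G F) ((Finset.subset_insert v F).trans (subset_closedNbhd G _))
      (fun _ _ _ => Iff.rfl) (fun x hx y hxy => ⟨labelGraph_adj_mem hx hxy,
        labelGraph_adj_mem (Finset.mem_insert_of_mem hx) hxy⟩) c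
  simp only [labeledWeight, h1]
  have h2 : ∀ a e, colorComponent (update c v a) e = update (colorComponent c e) v
      ((Fintype.equivFinOfCardEq (card_sym2_fun_fin d)).symm a e) := by
    intro a e
    ext x
    by_cases hx : x = v
    · subst hx
      simp [colorComponent]
    · simp [colorComponent, hx]
  simp only [h2]
  rw [(Fintype.equivFinOfCardEq (card_sym2_fun_fin d)).symm.sum_comp
    fun b : Sym2 (Fin d) → Fin 3 => ∏ e, localWeight (labelGraph G ℓ e)
      (closedNbhd G (insert v F)) (insert v F) (update (colorComponent c e) v (b e))]
  -- A color is a function on `Sym2 (Fin d)`, so the sum over colors of a product over pairs is the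
  -- product of the sums over 3-colors.
  refine (Fintype.prod_sum fun e b => localWeight (labelGraph G ℓ e)
    (closedNbhd G (insert v F)) (insert v F) (update (colorComponent c e) v b)).symm.trans ?_
  exact Finset.prod_congr rfl fun e _ => sum_localWeight_update hvW hv _

/-- The degree bound makes all labels defined, so the edge `uv` belongs to the graph of its own
pair, and that component of the color distinguishes its ends. -/
theorem coloringWeight_eq_zero (hd : ∀ v, Nat.card (G.neighborSet v) ≤ d) {F : Finset V}
    {u v : V} (hu : u ∈ F) (hv : v ∈ F) (huv : G.Adj u v) {c : V → Fin (3 ^ (d * (d + 1) / 2))}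
    (hc : c u = c v) : coloringWeight G F c = 0 := by
  refine integral_eq_zero_of_ae (ae_of_all _ fun ℓ => ?_)
  obtain ⟨i, hi⟩ := Option.isSome_iff_exists.1 ((ℓ u).2.2 (hd u) ⟨v, huv⟩)
  obtain ⟨j, hj⟩ := Option.isSome_iff_exists.1 ((ℓ v).2.2 (hd v) ⟨u, huv.symm⟩)
  refine Finset.prod_eq_zero (Finset.mem_univ s(i, j)) ?_
  refine localWeight_eq_zero (subset_closedNbhd G F) hu hv ⟨huv, i, j, hi, hj, rfl⟩ ?_
  rw [colorComponent, colorComponent, hc]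

/-- Given the labels, the weight factorizes by `localWeight_union`; the two factors depend on the
labels of disjoint sets of vertices, which are independent. -/
theorem coloringWeight_union {A B : Finset V}
    (hAB : Disjoint (closedNbhd G A) (closedNbhd G B)) (c : V → Fin (3 ^ (d * (d + 1) / 2))) :
    coloringWeight G (A ∪ B) c = coloringWeight G A c * coloringWeight G B c := by
  have h1 : ∀ ℓ, labeledWeight G (A ∪ B) c ℓ = labeledWeight G A c ℓ * labeledWeight G B c ℓ := by
    intro ℓ
    rw [labeledWeight, labeledWeight, labeledWeight, ← Finset.prod_mul_distrib]
    refine Finset.prod_congr rfl fun e _ => ?_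
    rw [← localWeight_union (labelGraph_degreeLETwo G ℓ e) (subset_closedNbhd G A)
      (subset_closedNbhd G B) (fun x hx y => labelGraph_adj_mem hx)
      (fun x hx y => labelGraph_adj_mem hx) hAB]
    congr 1
    ext y
    simp only [mem_closedNbhd, Finset.mem_union]
    grind
  have hi : iIndepFun (fun v (ℓ : ∀ v, Labeling (G.neighborSet v) d) => ℓ v) (labelLaw G d) :=
    iIndepFun_infinitePi (X := fun _ x => x) fun _ => measurable_id
  have hi2 := hi.indepFun_finset _ _ hAB fun v => measurable_pi_apply v
  obtain ⟨g, hg⟩ := exists_labeledWeight_eq_comp (G := G) A c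
  obtain ⟨g', hg'⟩ := exists_labeledWeight_eq_comp (G := G) B c
  simp only [coloringWeight, h1]
  have hi3 : IndepFun (labeledWeight G A c) (labeledWeight G B c) (labelLaw G d) := by
    rw [funext hg, funext hg']
    exact hi2.comp (measurable_of_countable g) (measurable_of_countable g')
  exact hi3.integral_mul_eq_mul_integral (integrable_labeledWeight _ _).aestronglyMeasurable
    (integrable_labeledWeight _ _).aestronglyMeasurable

end

/-- The bijection between the neighborhoods of `x` and `ι x` induced by the local isomorphism
`ι`. -/
noncomputable def neighborEquiv {G : SimpleGraph V} {G' : SimpleGraph V'} (ι : V' ↪ V) {x : V'}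
    (h : ∀ y, G.Adj (ι x) y ↔ ∃ y', ι y' = y ∧ G'.Adj x y') :
    G'.neighborSet x ≃ G.neighborSet (ι x) :=
  Equiv.ofBijective (fun y => ⟨ι y, (h _).2 ⟨y, rfl, y.2⟩⟩)
    ⟨fun y z hyz => Subtype.ext (ι.injective (congrArg Subtype.val hyz)), fun y => by
      obtain ⟨y', hy', h'⟩ := (h y).1 y.2
      exact ⟨⟨y', h'⟩, Subtype.ext hy'⟩⟩

theorem coloringWeight_map (ι : V' ↪ V) {G : SimpleGraph V} {G' : SimpleGraph V'}
    [∀ v, Finite (G.neighborSet v)] [∀ v, Finite (G'.neighborSet v)] {F : Finset V'}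
    (h : ∀ x ∈ closedNbhd G' F, ∀ y, G.Adj (ι x) y ↔ ∃ y', ι y' = y ∧ G'.Adj x y')
    {c' : V' → Fin (3 ^ (d * (d + 1) / 2))} {c : V → Fin (3 ^ (d * (d + 1) / 2))}
    (hc : ∀ x ∈ F, c' x = c (ι x)) :
    coloringWeight G' F c' = coloringWeight G (F.map ι) c := by
  -- Labels of `G` transported to `G'`. Bijections of neighborhoods preserve uniformity and
  -- injectivity of `ι` preserves independence, so their law is that of the labels of `G'` on the
  -- closed neighborhood of `F`.
  set t : (∀ v, Labeling (G.neighborSet v) d) →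
      ∀ x : closedNbhd G' F, Labeling (G'.neighborSet x) d :=
    fun ℓ x => Labeling.pull (neighborEquiv ι (h x x.2)) (ℓ (ι x)) with ht
  have ht_law : (labelLaw G d).map t = Measure.infinitePi fun _ => uniformOn Set.univ := by
    have h1 : Injective fun x : closedNbhd G' F => ι x := ι.injective.comp Subtype.val_injective
    have h2 := Measure.map_infinitePi_infinitePi_of_inj
      (P := fun v => uniformOn (Set.univ : Set (Labeling (G.neighborSet v) d))) h1
    have h3 := Measure.infinitePi_map_pi (fun x : closedNbhd G' F =>
      uniformOn (Set.univ : Set (Labeling (G.neighborSet (ι x)) d)))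
      (f := fun x => Labeling.pull (neighborEquiv ι (h x x.2))) fun _ => measurable_of_countable _
    simp only [map_uniformOn_univ] at h3
    rw [← h3, ← h2, Measure.map_map (by fun_prop) (by fun_prop)]
    rfl
  have ht_law' : (labelLaw G' d).map (fun ℓ (x : closedNbhd G' F) => ℓ x) =
      Measure.infinitePi fun _ => uniformOn Set.univ :=
    Measure.map_infinitePi_infinitePi_of_inj Subtype.val_injective
  have htm : Measurable t := by
    refine measurable_pi_lambda _ fun x => ?_
    exact (measurable_of_countable _).comp (measurable_pi_apply (ι x))
  obtain ⟨g, hg⟩ := exists_labeledWeight_eq_comp (G := G') F c'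
  have key : ∀ ℓ, labeledWeight G (F.map ι) c ℓ = g (t ℓ) := by
    intro ℓ
    obtain ⟨ℓ', hℓ'⟩ : ∃ ℓ' : ∀ v, Labeling (G'.neighborSet v) d,
        ∀ x : closedNbhd G' F, ℓ' x = t ℓ x :=
      ⟨fun v => if hv : v ∈ closedNbhd G' F then t ℓ ⟨v, hv⟩ else Classical.arbitrary _,
        fun x => dif_pos x.2⟩
    rw [← funext hℓ', ← hg]
    refine Finset.prod_congr rfl fun e _ => ?_
    symm
    have hℓ : ∀ x (hx : x ∈ closedNbhd G' F) y (hxy : G'.Adj x y) (hxy' : G.Adj (ι x) (ι y)),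
        (ℓ' x).1 ⟨y, hxy⟩ = (ℓ (ι x)).1 ⟨ι y, hxy'⟩ := by
      intro x hx y hxy hxy'
      rw [hℓ' ⟨x, hx⟩]
      rfl
    refine localWeight_map ι (labelGraph_degreeLETwo _ _ _) (labelGraph_degreeLETwo _ _ _)
      (subset_closedNbhd _ _) (subset_closedNbhd _ _) ?_ ?_ ?_
    · intro x hx y
      have hxW := subset_closedNbhd G' F hx
      constructor
      · rintro ⟨hxy, i, j, hi, hj, he⟩
        obtain ⟨y', rfl, hxy'⟩ := (h x hxW y).1 hxy
        have hyW : y' ∈ closedNbhd G' F := mem_closedNbhd.2 (Or.inr ⟨x, hx, hxy'⟩)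
        refine ⟨y', rfl, hxy', i, j, ?_, ?_, he⟩
        · rw [hℓ x hxW y' hxy' hxy, hi]
        · rw [hℓ y' hyW x hxy'.symm hxy.symm, hj]
      · rintro ⟨y', rfl, hxy', i, j, hi, hj, he⟩
        have hyW : y' ∈ closedNbhd G' F := mem_closedNbhd.2 (Or.inr ⟨x, hx, hxy'⟩)
        have hxy := (h x hxW (ι y')).2 ⟨y', rfl, hxy'⟩
        refine ⟨hxy, i, j, ?_, ?_, he⟩
        · rw [← hℓ x hxW y' hxy' hxy, hi]
        · rw [← hℓ y' hyW x hxy'.symm hxy.symm, hj]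
    · intro x hx y hxy
      refine ⟨labelGraph_adj_mem hx hxy, mem_closedNbhd.2 (Or.inr ⟨ι x, ?_, ?_⟩)⟩
      · exact Finset.mem_map_of_mem ι hx
      · exact (h x (subset_closedNbhd G' F hx) _).2 ⟨y, rfl, hxy.1⟩
    · intro x hx
      rw [colorComponent, colorComponent, hc x hx]
  rw [coloringWeight, coloringWeight, funext key, funext hg]
  rw [← integral_map (φ := t) htm.aemeasurable (measurable_of_countable g).aestronglyMeasurable,
    ← integral_map (φ := fun (ℓ : ∀ v, Labeling (G'.neighborSet v) d) (x : closedNbhd G' F) => ℓ x)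
      (measurable_pi_lambda _ fun x => measurable_pi_apply x.1).aemeasurable
      (measurable_of_countable g).aestronglyMeasurable, ht_law, ht_law']

end Labels

/-! ### The law of the coloring of a locally finite graph -/

section ColoringLaw

open scoped Classical
open Function

variable {V V' : Type*} {d : ℕ}

theorem exists_coloringLaw (G : SimpleGraph V) [∀ v, Finite (G.neighborSet v)] (d : ℕ) :
    ∃ P : Measure (V → Fin (3 ^ (d * (d + 1) / 2))), IsProbabilityMeasure P ∧
      ∀ F c, P {c' | ∀ x ∈ F, c' x = c x} = ENNReal.ofReal (coloringWeight G F c) :=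
  exists_measure_of_cylinderWeight (fun _ _ => coloringWeight_nonneg _ _)
    (fun _ _ _ => coloringWeight_congr) coloringWeight_empty
    fun _ _ hv => sum_coloringWeight_update hv

/-- The law of a random coloring of `G`, which is proper if all the degrees are at most `d`. -/
noncomputable def coloringLaw (G : SimpleGraph V) [∀ v, Finite (G.neighborSet v)] (d : ℕ) :
    Measure (V → Fin (3 ^ (d * (d + 1) / 2))) :=
  (exists_coloringLaw G d).choose

instance (G : SimpleGraph V) [∀ v, Finite (G.neighborSet v)] (d : ℕ) :
    IsProbabilityMeasure (coloringLaw G d) :=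
  (exists_coloringLaw G d).choose_spec.1

theorem coloringLaw_cylinder (G : SimpleGraph V) [∀ v, Finite (G.neighborSet v)]
    (F : Finset V) (c : V → Fin (3 ^ (d * (d + 1) / 2))) :
    coloringLaw G d {c' | ∀ x ∈ F, c' x = c x} = ENNReal.ofReal (coloringWeight G F c) :=
  (exists_coloringLaw G d).choose_spec.2 F c

/-- The law of the coloring of a finite set is determined by the neighborhoods of the set and of
its neighbors. -/
theorem coloringLaw_map (ι : V' ↪ V) {G : SimpleGraph V} {G' : SimpleGraph V'}
    [∀ v, Finite (G.neighborSet v)] [∀ v, Finite (G'.neighborSet v)] {F : Finset V'}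
    (h : ∀ x ∈ closedNbhd G' F, ∀ y, G.Adj (ι x) y ↔ ∃ y', ι y' = y ∧ G'.Adj x y') :
    (coloringLaw G d).map (fun c (x : F) => c (ι x)) =
      (coloringLaw G' d).map (fun c (x : F) => c x) := by
  refine Measure.ext_of_singleton fun y => ?_
  rw [Measure.map_apply (by fun_prop) (measurableSet_singleton y),
    Measure.map_apply (by fun_prop) (measurableSet_singleton y)]
  obtain ⟨c', hc'⟩ : ∃ c' : V' → Fin (3 ^ (d * (d + 1) / 2)), ∀ x : F, c' x = y x :=
    ⟨fun v => if hv : v ∈ F then y ⟨v, hv⟩ else Classical.arbitrary _, fun x => dif_pos x.2⟩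
  have hc : ∀ x, extend ι c' (fun _ => Classical.arbitrary _) (ι x) = c' x := fun x =>
    ι.injective.extend_apply _ _ _
  have h1 : (fun (c : V' → Fin (3 ^ (d * (d + 1) / 2))) (x : F) => c x) ⁻¹' {y} =
      {c | ∀ x ∈ F, c x = c' x} := by
    ext c
    simp [funext_iff, ← hc']
  have h2 : (fun (c : V → Fin (3 ^ (d * (d + 1) / 2))) (x : F) => c (ι x)) ⁻¹' {y} =
      {c | ∀ x ∈ F.map ι, c x = extend ι c' (fun _ => Classical.arbitrary _) x} := by
    ext c
    simp [funext_iff, ← hc', hc]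
  rw [h1, h2, coloringLaw_cylinder, coloringLaw_cylinder,
    coloringWeight_map ι h fun x _ => (hc x).symm]

/-- The law was picked by choice, but its finite marginals determine it, and these are invariant by
`coloringLaw_map`. -/
theorem coloringLaw_map_iso {G : SimpleGraph V} {G' : SimpleGraph V'}
    [∀ v, Finite (G.neighborSet v)] [∀ v, Finite (G'.neighborSet v)] (φ : G' ≃g G) :
    (coloringLaw G d).map (fun c x => c (φ x)) = coloringLaw G' d := by
  have hP : IsProjectiveLimit (coloringLaw G' d)
      fun F : Finset V' => (coloringLaw G' d).map (fun c (x : F) => c x) := fun F => rfl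
  refine IsProjectiveLimit.unique (P := fun F : Finset V' =>
    (coloringLaw G' d).map (fun c (x : F) => c x)) (fun F => ?_) hP
  rw [Measure.map_map (by fun_prop) (by fun_prop)]
  refine coloringLaw_map φ.toEquiv.toEmbedding fun x _ y => ?_
  constructor
  · intro hxy
    exact ⟨φ.symm y, φ.apply_symm_apply y, by
      rw [← φ.map_adj_iff, φ.apply_symm_apply]; exact hxy⟩
  · rintro ⟨y', rfl, hy'⟩
    exact φ.map_adj_iff.2 hy'

/-- It suffices to treat finite subsets. Sets at distance greater than 2 have disjoint closed
neighborhoods, so `coloringWeight_union` applies. -/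
theorem coloringLaw_isDependent (G : SimpleGraph V) [∀ v, Finite (G.neighborSet v)] (d : ℕ) :
    IsDependent G 2 (coloringLaw G d) := by
  intro A B hAB
  refine IndepFun.process_indepFun_process (X := fun (a : A) (c : V → Fin _) => c a)
    (Y := fun (b : B) (c : V → Fin _) => c b)
    (fun a => measurable_pi_apply _) (fun b => measurable_pi_apply _) fun I J => ?_
  rw [indepFun_iff_map_prod_eq_prod_map_map
    (measurable_pi_lambda _ fun i => measurable_pi_apply _).aemeasurable
    (measurable_pi_lambda _ fun j => measurable_pi_apply _).aemeasurable]
  refine Measure.ext_of_singleton fun ⟨y, z⟩ => ?_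
  rw [← Set.singleton_prod_singleton, Measure.prod_prod,
    Measure.map_apply (by fun_prop) (measurableSet_singleton y),
    Measure.map_apply (by fun_prop) (measurableSet_singleton z),
    Measure.map_apply (by fun_prop) ((measurableSet_singleton y).prod (measurableSet_singleton z))]
  set I' : Finset V := I.map (Embedding.subtype _) with hI'
  set J' : Finset V := J.map (Embedding.subtype _) with hJ'
  have hI'A : ∀ x ∈ I', x ∈ A := by simp +contextual [hI']
  have hJ'B : ∀ x ∈ J', x ∈ B := by simp +contextual [hJ']
  have hdist : ∀ (F : Finset V), ∀ x ∈ closedNbhd G F, ∃ a ∈ F, G.edist a x ≤ 1 := by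
    intro F x hx
    rcases mem_closedNbhd.1 hx with hx | ⟨a, ha, hax⟩
    · exact ⟨x, hx, by simp⟩
    · exact ⟨a, ha, (SimpleGraph.edist_eq_one_iff_adj.2 hax).le⟩
  have hdisj : Disjoint (closedNbhd G I') (closedNbhd G J') := by
    refine Finset.disjoint_left.2 fun x hx hx' => ?_
    obtain ⟨a, ha, hax⟩ := hdist _ x hx
    obtain ⟨b, hb, hbx⟩ := hdist _ x hx'
    refine (hAB a (hI'A a ha) b (hJ'B b hb)).not_ge ?_
    calc G.edist a b ≤ G.edist a x + G.edist x b := G.edist_triangle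
      _ ≤ 1 + 1 := add_le_add hax (SimpleGraph.edist_comm.trans_le hbx)
      _ = (2 : ℕ) := by norm_num
  have hdisj' := hdisj.mono (subset_closedNbhd G I') (subset_closedNbhd G J')
  obtain ⟨c₀, hc₁, hc₂⟩ : ∃ c₀ : V → Fin (3 ^ (d * (d + 1) / 2)),
      (∀ i : I, c₀ i = y i) ∧ ∀ j : J, c₀ j = z j := by
    have hmemI : ∀ i : I, (i : V) ∈ I' := fun i => Finset.mem_map_of_mem _ i.2
    have hmemJ : ∀ j : J, (j : V) ∈ J' := fun j => Finset.mem_map_of_mem _ j.2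
    have hiI : Injective fun i : I => (i : V) := fun i j h => Subtype.ext (Subtype.ext h)
    have hiJ : Injective fun j : J => (j : V) := fun i j h => Subtype.ext (Subtype.ext h)
    refine ⟨fun v => if v ∈ I' then extend (fun i : I => (i : V)) y
      (fun _ => Classical.arbitrary _) v else extend (fun j : J => (j : V)) z
      (fun _ => Classical.arbitrary _) v, fun i => ?_, fun j => ?_⟩
    · simp only [if_pos (hmemI i)]
      exact hiI.extend_apply _ _ _
    · simp only [if_neg (Finset.disjoint_right.1 hdisj' (hmemJ j))]
      exact hiJ.extend_apply _ _ _
  have h1 : (fun (c : V → Fin (3 ^ (d * (d + 1) / 2))) (i : I) => c i) ⁻¹' {y} =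
      {c | ∀ x ∈ I', c x = c₀ x} := by
    ext c
    simp only [Set.mem_preimage, Set.mem_singleton_iff, funext_iff, ← hc₁, Set.mem_ofPred_eq, hI',
      Finset.forall_mem_map, Embedding.subtype_apply]
    exact ⟨fun h i hi => h ⟨i, hi⟩, fun h i => h i i.2⟩
  have h2 : (fun (c : V → Fin (3 ^ (d * (d + 1) / 2))) (j : J) => c j) ⁻¹' {z} =
      {c | ∀ x ∈ J', c x = c₀ x} := by
    ext c
    simp only [Set.mem_preimage, Set.mem_singleton_iff, funext_iff, ← hc₂, Set.mem_ofPred_eq, hJ',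
      Finset.forall_mem_map, Embedding.subtype_apply]
    exact ⟨fun h i hi => h ⟨i, hi⟩, fun h i => h i i.2⟩
  have h3 : (fun c : V → Fin (3 ^ (d * (d + 1) / 2)) =>
      ((fun (i : I) => c i : I → Fin (3 ^ (d * (d + 1) / 2))), fun (j : J) => c j)) ⁻¹'
        ({y} ×ˢ {z}) = {c | ∀ x ∈ I' ∪ J', c x = c₀ x} := by
    rw [Set.mk_preimage_prod, h1, h2]
    ext c
    simp only [Set.mem_inter_iff, Set.mem_ofPred_eq, Finset.mem_union]
    grind
  rw [h1, h2]
  refine (congrArg _ h3).trans ?_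
  rw [coloringLaw_cylinder, coloringLaw_cylinder, coloringLaw_cylinder,
    coloringWeight_union hdisj, ENNReal.ofReal_mul (coloringWeight_nonneg _ _)]

theorem coloringLaw_proper [Countable V] {G : SimpleGraph V} [∀ v, Finite (G.neighborSet v)]
    (hd : ∀ v, Nat.card (G.neighborSet v) ≤ d) :
    ∀ᵐ c ∂coloringLaw G d, ∀ v w, G.Adj v w → c v ≠ c w := by
  rw [ae_all_iff]
  intro v
  rw [ae_all_iff]
  intro w
  by_cases hvw : G.Adj v w
  swap
  · exact ae_of_all _ fun c h => absurd h hvw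
  simp only [hvw, forall_const, ae_iff, not_not]
  -- The event `c v = c w` is split according to the common color `a`.
  refine measure_mono_null (t := ⋃ a, {c | ∀ x ∈ ({v, w} : Finset V), c x = a}) (fun c hc => ?_)
    (measure_iUnion_null fun a => ?_)
  · simp only [Set.mem_iUnion, Set.mem_ofPred_eq]
    exact ⟨c v, by simpa using hc.symm⟩
  · have := coloringLaw_cylinder G {v, w} fun _ : V => a
    rw [this, coloringWeight_eq_zero hd (by simp) (by simp) hvw rfl, ENNReal.ofReal_zero]

end ColoringLaw

/-! ### Balls, local isomorphisms and measurability -/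

section LocalTopology

open scoped Classical
open Function

theorem SimpleGraph.Connected.exists_adj_of_dist_le {V : Type*} {G : SimpleGraph V}
    (hG : G.Connected) {x y : V} {r : ℕ} (h : G.dist x y ≤ r + 1) :
    G.dist x y ≤ r ∨ ∃ z, G.dist x z ≤ r ∧ G.Adj z y := by
  obtain ⟨p, hp⟩ := hG.exists_walk_length_eq_dist y x
  rw [SimpleGraph.dist_comm] at hp
  cases p with
  | nil => exact Or.inl (by simp)
  | cons hadj p =>
    rw [SimpleGraph.Walk.length_cons] at hp
    refine Or.inr ⟨_, ?_, hadj.symm⟩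
    rw [SimpleGraph.dist_comm]
    exact (SimpleGraph.dist_le p).trans (by omega)

/-- An isomorphism between induced subgraphs preserves small distances from a vertex, if the first
subgraph contains the ball around that vertex. -/
theorem SimpleGraph.Connected.dist_le_of_induce_iso {V V' : Type*} {G : SimpleGraph V}
    {G' : SimpleGraph V'} (hG : G.Connected) (hG' : G'.Connected) {U : Set V} {U' : Set V'}
    (φ : G.induce U ≃g G'.induce U') {x : U} {r : ℕ} (hU : ∀ y, G.dist x y ≤ r → y ∈ U)
    {k : ℕ} (hk : k ≤ r) {y : U} (h : G.dist x y ≤ k) : G'.dist (φ x) (φ y) ≤ k := by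
  induction k generalizing y with
  | zero =>
    have : x = y := Subtype.ext (hG.dist_eq_zero_iff.1 (by omega))
    simp [this]
  | succ k ih =>
    rcases hG.exists_adj_of_dist_le h with h | ⟨z, hz, hzy⟩
    · exact (ih (by omega) h).trans (by omega)
    · have h1 := ih (y := ⟨z, hU z (by omega)⟩) (by omega) hz
      have h2 : G'.Adj (φ ⟨z, hU z (by omega)⟩) (φ y) := by
        have : (G.induce U).Adj ⟨z, hU z (by omega)⟩ y := hzy
        exact φ.map_adj_iff.2 this
      calc G'.dist (φ x) (φ y) ≤ _ + _ := hG'.dist_triangle (v := (φ ⟨z, hU z (by omega)⟩ : V'))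
        _ ≤ k + 1 := add_le_add h1 (SimpleGraph.dist_eq_one_iff_adj.2 h2).le

namespace RootedGraph

variable {K : Type} {n : ℕ}

instance (Γ : RootedGraph K n) (v : Γ.V) : Finite (Γ.graph.neighborSet v) :=
  (Γ.locallyFinite v).to_subtype

theorem root_mem_ball (Γ : RootedGraph K n) (r : ℕ) (i : Fin n) : Γ.root i ∈ Γ.ball r :=
  ⟨i, by simp⟩

theorem ball_subset (Γ : RootedGraph K n) {r R : ℕ} (h : r ≤ R) : Γ.ball r ⊆ Γ.ball R :=
  fun _ ⟨i, hi⟩ => ⟨i, hi.trans h⟩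

theorem mem_ball_of_adj (Γ : RootedGraph K n) {r : ℕ} {x y : Γ.V} (hx : x ∈ Γ.ball r)
    (h : Γ.graph.Adj x y) : y ∈ Γ.ball (r + 1) := by
  obtain ⟨i, hi⟩ := hx
  refine ⟨i, (Γ.connected.dist_triangle (v := x)).trans ?_⟩
  rw [SimpleGraph.dist_eq_one_iff_adj.2 h]
  omega

theorem finite_ball (Γ : RootedGraph K n) (r : ℕ) : (Γ.ball r).Finite := by
  induction r with
  | zero =>
    refine (Set.finite_range Γ.root).subset fun v ⟨i, hi⟩ => ⟨i, ?_⟩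
    exact Γ.connected.dist_eq_zero_iff.1 (by omega)
  | succ r ih =>
    refine (ih.union (ih.biUnion fun x _ => Γ.locallyFinite x)).subset fun v ⟨i, hi⟩ => ?_
    rcases Γ.connected.exists_adj_of_dist_le hi with h | ⟨z, hz, hzv⟩
    · exact Or.inl ⟨i, h⟩
    · exact Or.inr (Set.mem_biUnion (show z ∈ Γ.ball r from ⟨i, hz⟩) hzv)

theorem countable_V (Γ : RootedGraph K (n + 1)) : Countable Γ.V := by
  have : (Set.univ : Set Γ.V) = ⋃ r, Γ.ball r :=
    (Set.eq_univ_of_forall fun v => Set.mem_iUnion.2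
      ⟨Γ.graph.dist (Γ.root 0) v, show v ∈ Γ.ball _ from ⟨0, le_rfl⟩⟩).symm
  rw [← Set.countable_univ_iff, this]
  exact Set.countable_iUnion fun r => (Γ.finite_ball r).countable

theorem mem_ball_of_iso {Γ : RootedGraph K n} {K' : Type} {Γ' : RootedGraph K' n} {U : Set Γ.V}
    {U' : Set Γ'.V} (φ : Γ.graph.induce U ≃g Γ'.graph.induce U') {r : ℕ} (hU : Γ.ball r ⊆ U)
    (hroot : ∀ i (h : Γ.root i ∈ U), (φ ⟨Γ.root i, h⟩ : Γ'.V) = Γ'.root i) {v : U}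
    (hv : (v : Γ.V) ∈ Γ.ball r) : (φ v : Γ'.V) ∈ Γ'.ball r := by
  obtain ⟨i, hi⟩ := hv
  refine ⟨i, ?_⟩
  rw [← hroot i (hU (Γ.root_mem_ball r i))]
  exact Γ.connected.dist_le_of_induce_iso Γ'.connected φ (x := ⟨Γ.root i, _⟩) (r := r)
    (fun y hy => hU ⟨i, hy⟩) le_rfl hi

theorem symm_root {Γ : RootedGraph K n} {K' : Type} {Γ' : RootedGraph K' n} {U : Set Γ.V}
    {U' : Set Γ'.V} (φ : Γ.graph.induce U ≃g Γ'.graph.induce U')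
    (hU : ∀ i, Γ.root i ∈ U)
    (hroot : ∀ i (h : Γ.root i ∈ U), (φ ⟨Γ.root i, h⟩ : Γ'.V) = Γ'.root i) :
    ∀ i (h : Γ'.root i ∈ U'), (φ.symm ⟨Γ'.root i, h⟩ : Γ.V) = Γ.root i := by
  intro i h
  have : (⟨Γ'.root i, h⟩ : U') = φ ⟨Γ.root i, hU i⟩ := Subtype.ext (hroot i _).symm
  rw [this, φ.symm_apply_apply]

/-- An isomorphism of subgraphs which contain the balls of radius `r` restricts to them. -/
theorem ballIso_of_iso {Γ Γ' : RootedGraph K n} {U : Set Γ.V} {U' : Set Γ'.V}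
    (φ : Γ.graph.induce U ≃g Γ'.graph.induce U') {r : ℕ} (hU : Γ.ball r ⊆ U)
    (hU' : Γ'.ball r ⊆ U')
    (hroot : ∀ i (h : Γ.root i ∈ U), (φ ⟨Γ.root i, h⟩ : Γ'.V) = Γ'.root i)
    (hmark : ∀ v : U, (v : Γ.V) ∈ Γ.ball r → Γ'.mark (φ v) = Γ.mark v) : Γ.BallIso r Γ' := by
  have hroot' := symm_root φ (fun i => hU (Γ.root_mem_ball r i)) hroot
  let ψ : Γ.graph.induce (Γ.ball r) ≃g Γ'.graph.induce (Γ'.ball r) :=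
    { toFun := fun v => ⟨φ ⟨v, hU v.2⟩, mem_ball_of_iso φ hU hroot v.2⟩
      invFun := fun v => ⟨φ.symm ⟨v, hU' v.2⟩, mem_ball_of_iso φ.symm hU' hroot' v.2⟩
      left_inv := fun v => by simp
      right_inv := fun v => by simp
      map_rel_iff' := fun {v w} => by
        have := φ.map_adj_iff (v := ⟨v, hU v.2⟩) (w := ⟨w, hU w.2⟩)
        exact this }
  exact ⟨ψ, fun i h => hroot i (hU h), fun v => hmark ⟨v, hU v.2⟩ v.2⟩

theorem BallIso.symm {Γ Γ' : RootedGraph K n} {r : ℕ} (h : Γ.BallIso r Γ') : Γ'.BallIso r Γ := by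
  obtain ⟨φ, hroot, hmark⟩ := h
  refine ⟨φ.symm, symm_root φ (Γ.root_mem_ball r) hroot, fun v => ?_⟩
  rw [← hmark (φ.symm v), φ.apply_symm_apply]

theorem BallIso.trans {Γ Γ' Γ'' : RootedGraph K n} {r : ℕ} (h : Γ.BallIso r Γ')
    (h' : Γ'.BallIso r Γ'') : Γ.BallIso r Γ'' := by
  obtain ⟨φ, hroot, hmark⟩ := h
  obtain ⟨φ', hroot', hmark'⟩ := h'
  refine ⟨φ.trans φ', fun i hi => ?_, fun v => ?_⟩
  · have : φ ⟨Γ.root i, hi⟩ = ⟨Γ'.root i, Γ'.root_mem_ball r i⟩ := Subtype.ext (hroot i hi)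
    rw [← hroot' i (Γ'.root_mem_ball r i), ← this]
    rfl
  · rw [← hmark v, ← hmark' (φ v)]
    rfl

theorem BallIso.mono {Γ Γ' : RootedGraph K n} {r R : ℕ} (hr : r ≤ R) (h : Γ.BallIso R Γ') :
    Γ.BallIso r Γ' := by
  obtain ⟨φ, hroot, hmark⟩ := h
  exact ballIso_of_iso φ (Γ.ball_subset hr) (Γ'.ball_subset hr) hroot fun v _ => hmark v

theorem IsRootedIso.ballIso {Γ Γ' : RootedGraph K n} {φ : Γ.graph ≃g Γ'.graph}
    (h : IsRootedIso Γ Γ' φ) (r : ℕ) : Γ.BallIso r Γ' := by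
  refine ballIso_of_iso (U := Set.univ) (U' := Set.univ)
    ((SimpleGraph.induceUnivIso _).trans (φ.trans (SimpleGraph.induceUnivIso _).symm))
    (Set.subset_univ _) (Set.subset_univ _) (fun i _ => h.root i) (fun v _ => h.mark v)

/-- A description of a finite graph with roots and marks on the vertex set `Fin N`. -/
def Realizes (Γ : RootedGraph K n) (r : ℕ)
    (k : Σ N : ℕ, (Fin N → Fin N → Prop) × (Fin n → Fin N) × (Fin N → K)) : Prop :=
  ∃ e : Γ.ball r ≃ Fin k.1, (∀ v w : Γ.ball r, Γ.graph.Adj v w ↔ k.2.1 (e v) (e w)) ∧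
    (∀ i, e ⟨Γ.root i, Γ.root_mem_ball r i⟩ = k.2.2.1 i) ∧ ∀ v : Γ.ball r, Γ.mark v = k.2.2.2 (e v)

theorem exists_realizes (Γ : RootedGraph K n) (r : ℕ) : ∃ k, Γ.Realizes r k := by
  have : Finite (Γ.ball r) := (Γ.finite_ball r).to_subtype
  obtain ⟨N, ⟨e⟩⟩ := Finite.exists_equiv_fin (Γ.ball r)
  exact ⟨⟨N, fun a b => Γ.graph.Adj (e.symm a) (e.symm b),
    fun i => e ⟨Γ.root i, Γ.root_mem_ball r i⟩, fun a => Γ.mark (e.symm a)⟩, e, by simp, by simp,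
    by simp⟩

theorem Realizes.ballIso {Γ Γ' : RootedGraph K n} {r : ℕ}
    {k : Σ N : ℕ, (Fin N → Fin N → Prop) × (Fin n → Fin N) × (Fin N → K)} (h : Γ.Realizes r k)
    (h' : Γ'.Realizes r k) : Γ.BallIso r Γ' := by
  obtain ⟨e, h1, h2, h3⟩ := h
  obtain ⟨e', h1', h2', h3'⟩ := h'
  refine ⟨⟨e.trans e'.symm, fun {v w} => ?_⟩, fun i hi => ?_, fun v => ?_⟩
  · simp only [SimpleGraph.comap_adj, Embedding.subtype_apply, Equiv.trans_apply, h1, h1',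
      Equiv.apply_symm_apply]
  · have : e'.symm (e ⟨Γ.root i, hi⟩) = ⟨Γ'.root i, Γ'.root_mem_ball r i⟩ := by
      rw [Equiv.symm_apply_eq, h2', ← h2]
    exact congrArg Subtype.val this
  · have := h3' (e'.symm (e v))
    rw [Equiv.apply_symm_apply, ← h3] at this
    exact this

end RootedGraph

namespace RootedGraphClass

open RootedGraph

variable {K : Type} {n : ℕ}

theorem mk_eq_mk {Γ Γ' : RootedGraph K n} : mk Γ = mk Γ' ↔ ∃ φ, IsRootedIso Γ Γ' φ := by
  constructor
  · exact fun h => Quotient.exact h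
  · exact fun h => Quotient.sound h

theorem mk_out (g : RootedGraphClass K n) : mk g.out = g := Quotient.out_eq g

theorem ballIso_of_mk_eq {Γ Γ' : RootedGraph K n} (h : mk Γ = mk Γ') (r : ℕ) : Γ.BallIso r Γ' := by
  obtain ⟨φ, hφ⟩ := mk_eq_mk.1 h
  exact hφ.ballIso r

/-- The isomorphism classes whose balls of radius `r` are isomorphic to those of `Γ`. -/
def ballClass (r : ℕ) (Γ : RootedGraph K n) : Set (RootedGraphClass K n) :=
  {g | ∃ Γ', mk Γ' = g ∧ Γ.BallIso r Γ'}

theorem mk_mem_ballClass {r : ℕ} {Γ Γ' : RootedGraph K n} :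
    mk Γ' ∈ ballClass r Γ ↔ Γ.BallIso r Γ' :=
  ⟨fun ⟨_, h1, h2⟩ => h2.trans (ballIso_of_mk_eq h1 r), fun h => ⟨Γ', rfl, h⟩⟩

theorem measurableSet_ballClass (r : ℕ) (Γ : RootedGraph K n) : MeasurableSet (ballClass r Γ) :=
  MeasurableSpace.measurableSet_generateFrom ⟨r, Γ, rfl⟩

/-- Two such sets are nested or disjoint, since an isomorphism of larger balls restricts to the
smaller ones. -/
theorem isPiSystem_ballClass :
    IsPiSystem {B : Set (RootedGraphClass K n) | ∃ (r : ℕ) (Γ : RootedGraph K n),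
      B = ballClass r Γ} := by
  have key : ∀ (r r' : ℕ) (Γ Γ' : RootedGraph K n), r ≤ r' →
      (ballClass r Γ ∩ ballClass r' Γ').Nonempty →
      ballClass r Γ ∩ ballClass r' Γ' = ballClass r' Γ' := by
    rintro r r' Γ Γ' hr ⟨g, hg, hg'⟩
    rw [← mk_out g, mk_mem_ballClass] at hg hg'
    refine Set.inter_eq_right.2 fun h hh => ?_
    rw [← mk_out h, mk_mem_ballClass] at hh ⊢
    exact hg.trans ((hg'.symm.trans hh).mono hr)
  rintro _ ⟨r, Γ, rfl⟩ _ ⟨r', Γ', rfl⟩ hne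
  rcases le_total r r' with hr | hr
  · exact ⟨r', Γ', key r r' Γ Γ' hr hne⟩
  · rw [Set.inter_comm] at hne ⊢
    exact ⟨r, Γ, key r' r Γ' Γ hr hne⟩

/-- Finite graphs with roots and finitely many possible marks have countably many isomorphism types,
so `s` is a countable union of ball classes. -/
theorem measurableSet_of_local [Finite K] (r : ℕ) {s : Set (RootedGraphClass K n)}
    (hs : ∀ Γ Γ', Γ.BallIso r Γ' → mk Γ ∈ s → mk Γ' ∈ s) : MeasurableSet s := by
  have : s = ⋃ k, ⋃ h : ∃ Γ : RootedGraph K n, Γ.Realizes r k ∧ mk Γ ∈ s,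
      ballClass r h.choose := by
    ext g
    rw [← mk_out g]
    simp only [Set.mem_iUnion, mk_mem_ballClass]
    constructor
    · intro hg
      obtain ⟨k, hk⟩ := exists_realizes g.out r
      have h : ∃ Γ : RootedGraph K n, Γ.Realizes r k ∧ mk Γ ∈ s := ⟨g.out, hk, hg⟩
      exact ⟨k, h, h.choose_spec.1.ballIso hk⟩
    · rintro ⟨k, h, hk⟩
      exact hs _ _ hk h.choose_spec.2
  rw [this]
  exact MeasurableSet.iUnion fun k => MeasurableSet.iUnion fun h => measurableSet_ballClass r _

theorem measurable_of_local [Finite K] {Y : Type*} [MeasurableSpace Y] (r : ℕ)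
    {f : RootedGraphClass K n → Y} (hf : ∀ Γ Γ', Γ.BallIso r Γ' → f (mk Γ) = f (mk Γ')) :
    Measurable f := fun s _ => measurableSet_of_local r fun Γ Γ' h hΓ => by
  rw [Set.mem_preimage] at hΓ ⊢
  rwa [← hf Γ Γ' h]

theorem measurable_of_ballIso [Finite K] {K' : Type} {m : ℕ}
    {T : RootedGraphClass K n → RootedGraphClass K' m} {T' : RootedGraph K n → RootedGraph K' m}
    (hT : ∀ Γ, T (mk Γ) = mk (T' Γ))
    (h : ∀ r, ∃ R, ∀ Γ Γ', Γ.BallIso R Γ' → (T' Γ).BallIso r (T' Γ')) : Measurable T := by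
  refine measurable_generateFrom ?_
  rintro _ ⟨r, Δ, rfl⟩
  obtain ⟨R, hR⟩ := h r
  refine measurableSet_of_local R fun Γ Γ' hΓ hmem => ?_
  have h1 : ∀ Γ, mk Γ ∈ T ⁻¹' (ballClass r Δ) ↔ Δ.BallIso r (T' Γ) := fun Γ => by
    rw [Set.mem_preimage, hT, mk_mem_ballClass]
  exact (h1 Γ').2 (((h1 Γ).1 hmem).trans (hR Γ Γ' hΓ))

end RootedGraphClass

end LocalTopology

/-! ### The colored random graph -/

section RandomColoring

namespace RootedGraph

variable {K : Type} {n : ℕ}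

theorem ballIso_setMark {C : Type} (Γ : RootedGraph K n) {c c' : Γ.V → C} {r : ℕ}
    (h : ∀ v ∈ Γ.ball r, c v = c' v) : (Γ.setMark c).BallIso r (Γ.setMark c') :=
  ⟨SimpleGraph.Iso.refl, fun _ _ => rfl, fun v => (h v.1 v.2).symm⟩

theorem BallIso.setMark {Γ Γ' : RootedGraph K n} {C : Type} {r R : ℕ} (hr : r ≤ R)
    {φ : Γ.graph.induce (Γ.ball R) ≃g Γ'.graph.induce (Γ'.ball R)}
    (hroot : ∀ i (h : Γ.root i ∈ Γ.ball R), (φ ⟨Γ.root i, h⟩ : Γ'.V) = Γ'.root i)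
    {c : Γ.V → C} {c' : Γ'.V → C}
    (h : ∀ v : Γ.ball R, (v : Γ.V) ∈ Γ.ball r → c' (φ v) = c v) :
    (Γ.setMark c).BallIso r (Γ'.setMark c') :=
  ballIso_of_iso (Γ := Γ.setMark c) (Γ' := Γ'.setMark c') φ (Γ.ball_subset hr)
    (Γ'.ball_subset hr) hroot h

theorem ball_setRoots_subset (Γ : RootedGraph K 1) {x : Γ.V} {R r : ℕ}
    (hx : Γ.graph.dist (Γ.root 0) x ≤ R) :
    (Γ.setRoots ![Γ.root 0, x]).ball r ⊆ Γ.ball (R + r) := by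
  rintro v ⟨i, hi⟩
  refine ⟨0, ?_⟩
  fin_cases i
  · have hi : Γ.graph.dist (Γ.root 0) v ≤ r := hi
    omega
  · have hi : Γ.graph.dist x v ≤ r := hi
    exact (Γ.connected.dist_triangle (v := x)).trans (by omega)

/-- An isomorphism of balls maps spheres to spheres. -/
theorem BallIso.exists_sphere_equiv {Γ Γ' : RootedGraph K 1} {R r : ℕ}
    (h : Γ.BallIso (R + r) Γ') :
    ∃ e : {x // Γ.graph.dist (Γ.root 0) x = R} ≃ {x // Γ'.graph.dist (Γ'.root 0) x = R},
      ∀ x, (Γ.setRoots ![Γ.root 0, x.1]).BallIso r (Γ'.setRoots ![Γ'.root 0, (e x).1]) := by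
  obtain ⟨φ, hroot, hmark⟩ := h
  have hroot' := symm_root φ (Γ.root_mem_ball (R + r)) hroot
  have hS : ∀ {k}, k ≤ R → ∀ v : Γ.ball (R + r), Γ.graph.dist (Γ.root 0) v ≤ k →
      Γ'.graph.dist (Γ'.root 0) (φ v) ≤ k := fun hk v hv => by
    rw [← hroot 0 (Γ.root_mem_ball _ 0)]
    exact Γ.connected.dist_le_of_induce_iso Γ'.connected φ (x := ⟨Γ.root 0, _⟩) (r := R + r)
      (fun y hy => ⟨0, hy⟩) (hk.trans (Nat.le_add_right R r)) hv
  have hS' : ∀ {k}, k ≤ R → ∀ v : Γ'.ball (R + r), Γ'.graph.dist (Γ'.root 0) v ≤ k →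
      Γ.graph.dist (Γ.root 0) (φ.symm v) ≤ k := fun hk v hv => by
    rw [← hroot' 0 (Γ'.root_mem_ball _ 0)]
    exact Γ'.connected.dist_le_of_induce_iso Γ.connected φ.symm (x := ⟨Γ'.root 0, _⟩) (r := R + r)
      (fun y hy => ⟨0, hy⟩) (hk.trans (Nat.le_add_right R r)) hv
  have hSe : ∀ v : Γ.ball (R + r), Γ.graph.dist (Γ.root 0) v = R →
      Γ'.graph.dist (Γ'.root 0) (φ v) = R := fun v hv => by
    refine le_antisymm (hS le_rfl v hv.le) ?_
    by_contra hlt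
    have := hS' (not_le.1 hlt).le (φ v) le_rfl
    rw [φ.symm_apply_apply] at this
    omega
  have hSe' : ∀ v : Γ'.ball (R + r), Γ'.graph.dist (Γ'.root 0) v = R →
      Γ.graph.dist (Γ.root 0) (φ.symm v) = R := fun v hv => by
    refine le_antisymm (hS' le_rfl v hv.le) ?_
    by_contra hlt
    have := hS (not_le.1 hlt).le (φ.symm v) le_rfl
    rw [φ.apply_symm_apply] at this
    omega
  have hm : ∀ {x}, Γ.graph.dist (Γ.root 0) x = R → x ∈ Γ.ball (R + r) := fun hx =>
    ⟨0, by omega⟩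
  have hm' : ∀ {x}, Γ'.graph.dist (Γ'.root 0) x = R → x ∈ Γ'.ball (R + r) := fun hx =>
    ⟨0, by omega⟩
  refine ⟨{ toFun := fun x => ⟨φ ⟨x, hm x.2⟩, hSe _ x.2⟩
            invFun := fun x => ⟨φ.symm ⟨x, hm' x.2⟩, hSe' _ x.2⟩
            left_inv := fun x => by simp
            right_inv := fun x => by simp }, fun x => ?_⟩
  refine ballIso_of_iso (Γ := Γ.setRoots ![Γ.root 0, x.1])
    (Γ' := Γ'.setRoots ![Γ'.root 0, (φ ⟨x, hm x.2⟩).1]) φ (Γ.ball_setRoots_subset x.2.le) (Γ'.ball_setRoots_subset (hSe _ x.2).le) (fun i hi => ?_)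
    fun v _ => hmark v
  fin_cases i
  · exact hroot 0 hi
  · rfl

end RootedGraph

namespace RootedGraphClass

open RootedGraph

variable {K : Type} {n d : ℕ}

/-- Balls are finite, so preimages of ball classes are cylinders. -/
theorem measurable_mk_setMark {C : Type} [Finite C] [MeasurableSpace C]
    [MeasurableSingletonClass C] (Γ : RootedGraph K n) :
    Measurable fun c : Γ.V → C => mk (Γ.setMark c) := by
  refine measurable_generateFrom ?_
  rintro _ ⟨r, Δ, rfl⟩
  have : Finite (Γ.ball r) := (Γ.finite_ball r).to_subtype
  have h : (fun c : Γ.V → C => mk (Γ.setMark c)) ⁻¹' ballClass r Δ =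
      (fun c (v : Γ.ball r) => c v) ⁻¹'
        {y : Γ.ball r → C | ∃ c : Γ.V → C, (fun v : Γ.ball r => c v) = y ∧
          Δ.BallIso r (Γ.setMark c)} := by
    ext c
    simp only [Set.mem_preimage, mk_mem_ballClass]
    refine ⟨fun h => ⟨c, rfl, h⟩, ?_⟩
    rintro ⟨c', h, h'⟩
    exact h'.trans (Γ.ballIso_setMark fun v hv => congrFun h ⟨v, hv⟩)
  exact h ▸ (measurable_pi_lambda _ fun v => measurable_pi_apply _) (Set.toFinite _).measurableSet

/-- The law of the random coloring of an isomorphism class of rooted graphs. -/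
noncomputable def coloredLaw (d : ℕ) (g : RootedGraphClass K n) :
    Measure (RootedGraphClass (Fin (3 ^ (d * (d + 1) / 2))) n) :=
  (coloringLaw g.out.graph d).map fun c => mk (g.out.setMark c)

instance (g : RootedGraphClass K n) : IsProbabilityMeasure (coloredLaw d g) :=
  Measure.isProbabilityMeasure_map (measurable_mk_setMark _).aemeasurable

/-- Equivariance of the coloring law makes the chosen representative immaterial. -/
theorem coloredLaw_mk (Γ : RootedGraph K n) :
    coloredLaw d (mk Γ) = (coloringLaw Γ.graph d).map fun c => mk (Γ.setMark c) := by
  obtain ⟨φ, hφ⟩ := mk_eq_mk.1 (mk_out (mk Γ))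
  rw [coloredLaw, ← coloringLaw_map_iso φ, Measure.map_map
    (g := fun c : (mk Γ).out.V → Fin (3 ^ (d * (d + 1) / 2)) => mk ((mk Γ).out.setMark c))
    (f := fun (c : Γ.V → Fin (3 ^ (d * (d + 1) / 2))) x => c (φ x))
    (measurable_mk_setMark _) (measurable_pi_lambda _ fun v => measurable_pi_apply _)]
  refine congrArg (fun T => Measure.map T _) (funext fun c => ?_)
  exact mk_eq_mk.2 ⟨φ, hφ.root, fun _ => rfl⟩

theorem coloredLaw_mk_apply (Γ : RootedGraph K n)
    {B : Set (RootedGraphClass (Fin (3 ^ (d * (d + 1) / 2))) n)} (hB : MeasurableSet B) :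
    coloredLaw d (mk Γ) B = coloringLaw Γ.graph d {c | mk (Γ.setMark c) ∈ B} := by
  rw [coloredLaw_mk, Measure.map_apply (measurable_mk_setMark Γ) hB]
  rfl

/-- The colors in the ball of radius r depend on the labels given by vertices at distance at most r
+ 1, and these concern neighbors at distance at most r + 2. Both laws are compared with the one on
the finite graph induced by that larger ball. -/
theorem coloredLaw_ballClass_of_ballIso {Γ Γ' : RootedGraph K n} {r : ℕ}
    (h : Γ.BallIso (r + 2) Γ') (Δ : RootedGraph (Fin (3 ^ (d * (d + 1) / 2))) n) :
    coloredLaw d (mk Γ) (ballClass r Δ) = coloredLaw d (mk Γ') (ballClass r Δ) := by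
  classical
  obtain ⟨φ, hroot, -⟩ := h
  have hroot' := symm_root φ (Γ.root_mem_ball _) hroot
  have hfin : Finite (Γ.ball (r + 2)) := (Γ.finite_ball _).to_subtype
  have := Fintype.ofFinite (Γ.ball (r + 2))
  let G := Γ.graph.induce (Γ.ball (r + 2))
  let F : Finset (Γ.ball (r + 2)) := Finset.univ.filter fun v => (v : Γ.V) ∈ Γ.ball r
  have hF : ∀ x, x ∈ F ↔ (x : Γ.V) ∈ Γ.ball r := fun x => by simp [F]
  have hN : ∀ x ∈ closedNbhd G F, (x : Γ.V) ∈ Γ.ball (r + 1) := fun x hx => by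
    rcases mem_closedNbhd.1 hx with hx | ⟨y, hy, hyx⟩
    · exact Γ.ball_subset (Nat.le_succ r) ((hF x).1 hx)
    · exact Γ.mem_ball_of_adj ((hF y).1 hy) hyx
  have h1 := coloringLaw_map (d := d) (G := Γ.graph) (G' := G) (F := F)
    (Function.Embedding.subtype _) fun x hx y =>
      ⟨fun hxy => ⟨⟨y, Γ.mem_ball_of_adj (hN x hx) hxy⟩, rfl, hxy⟩, by rintro ⟨y, rfl, h⟩; exact h⟩
  have h2 := coloringLaw_map (d := d) (G := Γ'.graph) (G' := G) (F := F)
    (φ.toEquiv.toEmbedding.trans (Function.Embedding.subtype _)) fun x hx y => by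
      refine ⟨fun hxy => ?_, ?_⟩
      · have hy := Γ'.mem_ball_of_adj (mem_ball_of_iso φ (Γ.ball_subset (Nat.le_succ _)) hroot
          (hN x hx)) hxy
        refine ⟨φ.symm ⟨y, hy⟩, congrArg Subtype.val (φ.apply_symm_apply ⟨y, hy⟩), ?_⟩
        rw [← φ.map_adj_iff, φ.apply_symm_apply]
        exact hxy
      · rintro ⟨y, rfl, h⟩
        exact φ.map_adj_iff.2 h
  have h3 := h1.trans h2.symm
  -- Symmetric in the two graphs, so that both preimages are computed in the same way; the disjuncts
  -- are equivalent through `hiso`.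
  let E : Set (F → Fin (3 ^ (d * (d + 1) / 2))) := {y |
    (∃ c : Γ.V → _, (fun x : F => c x.1.1) = y ∧ Δ.BallIso r (Γ.setMark c)) ∨
    ∃ c : Γ'.V → _, (fun x : F => c (φ x.1).1) = y ∧ Δ.BallIso r (Γ'.setMark c)}
  have hiso : ∀ (c : Γ.V → Fin (3 ^ (d * (d + 1) / 2))) (c' : Γ'.V → _),
      (fun x : F => c x.1.1) = (fun x : F => c' (φ x.1).1) →
      (Γ.setMark c).BallIso r (Γ'.setMark c') := fun c c' hc =>
    BallIso.setMark (by omega) hroot fun v hv => (congrFun hc ⟨v, (hF v).2 hv⟩).symm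
  have hE := (Set.toFinite E).measurableSet
  rw [coloredLaw_mk_apply _ (measurableSet_ballClass _ _),
    coloredLaw_mk_apply _ (measurableSet_ballClass _ _)]
  have hm1 : Measurable fun (c : Γ.V → Fin (3 ^ (d * (d + 1) / 2))) (x : F) => c x.1.1 :=
    measurable_pi_lambda _ fun v => measurable_pi_apply _
  have hm2 : Measurable fun (c : Γ'.V → Fin (3 ^ (d * (d + 1) / 2))) (x : F) => c (φ x.1).1 :=
    measurable_pi_lambda _ fun v => measurable_pi_apply _
  have h4 := congrArg (fun m => m E) h3
  refine Eq.trans ?_ (((Measure.map_apply hm1 hE).symm.trans h4).trans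
    ((Measure.map_apply hm2 hE).trans ?_))
  · refine congrArg _ (Set.ext fun c => ?_)
    refine mk_mem_ballClass.trans ⟨fun h => Or.inl ⟨c, rfl, h⟩, ?_⟩
    rintro (⟨c', h, h'⟩ | ⟨c', h, h'⟩)
    · exact h'.trans (Γ.ballIso_setMark fun v hv =>
        congrFun h ⟨⟨v, Γ.ball_subset (by omega) hv⟩, (hF _).2 hv⟩)
    · exact h'.trans (hiso c c' h.symm).symm
  · refine congrArg _ (Set.ext fun c => ?_)
    refine (mk_mem_ballClass.trans ⟨fun h => Or.inr ⟨c, rfl, h⟩, ?_⟩).symm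
    rintro (⟨c', h, h'⟩ | ⟨c', h, h'⟩)
    · exact h'.trans (hiso c' c h)
    · refine h'.trans (Γ'.ballIso_setMark fun v hv => ?_)
      have hv2 : v ∈ Γ'.ball (r + 2) := Γ'.ball_subset (by omega) hv
      have hv' : (φ.symm ⟨v, hv2⟩ : Γ.V) ∈ Γ.ball r :=
        mem_ball_of_iso φ.symm (Γ'.ball_subset (by omega)) hroot' hv
      have := congrFun h ⟨φ.symm ⟨v, hv2⟩, (hF _).2 hv'⟩
      simpa using this

theorem measurable_coloredLaw [Finite K] :
    Measurable (coloredLaw d : RootedGraphClass K n → _) := by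
  refine Measurable.measure_of_isPiSystem_of_isProbabilityMeasure rfl isPiSystem_ballClass ?_
  rintro _ ⟨r, Δ, rfl⟩
  exact measurable_of_local (r + 2) fun Γ Γ' h => coloredLaw_ballClass_of_ballIso h Δ

/-! ### Measurability of the mass sent and received -/

/-- The point measures at the doubly rooted graphs whose second root is at distance `R`. -/
noncomputable def sphereMeasure (R : ℕ) (g : RootedGraphClass K 1) :
    Measure (RootedGraphClass K 2) :=
  Measure.sum fun x : {x // g.out.graph.dist (g.out.root 0) x = R} =>
    Measure.dirac (mk (g.out.setRoots ![g.out.root 0, x]))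

/-- Sorting the vertices by their distance from the root turns the mass into integrals against
finite measures, whose measurable dependence on `g` can be tested on ball classes. -/
theorem massOut_eq_tsum {f : RootedGraphClass K 2 → ℝ≥0∞} (hf : Measurable f)
    (g : RootedGraphClass K 1) : massOut f g = ∑' R, ∫⁻ h, f h ∂sphereMeasure R g := by
  conv_lhs => rw [← mk_out g]
  change ∑' x : g.out.V, f (mk (g.out.setRoots ![g.out.root 0, x])) = _
  rw [← (Equiv.sigmaFiberEquiv (fun x => g.out.graph.dist (g.out.root 0) x)).tsum_eq,
    ENNReal.tsum_sigma']
  refine tsum_congr fun R => ?_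
  rw [sphereMeasure, lintegral_sum_measure]
  refine tsum_congr fun x => ?_
  rw [lintegral_dirac' _ hf]
  rfl

instance (R : ℕ) (g : RootedGraphClass K 1) : IsFiniteMeasure (sphereMeasure R g) := by
  have : Finite {x // g.out.graph.dist (g.out.root 0) x = R} :=
    ((g.out.finite_ball R).subset fun x (hx : _ = R) => ⟨0, hx.le⟩).to_subtype
  have := Fintype.ofFinite {x // g.out.graph.dist (g.out.root 0) x = R}
  rw [sphereMeasure, Measure.sum_fintype]
  infer_instance

theorem measurable_sphereMeasure_apply [Finite K] (R : ℕ) {r : ℕ} {s : Set (RootedGraphClass K 2)}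
    (hs : ∀ Γ Γ', Γ.BallIso r Γ' → mk Γ ∈ s → mk Γ' ∈ s) :
    Measurable fun g : RootedGraphClass K 1 => sphereMeasure R g s := by
  have hms : MeasurableSet s := measurableSet_of_local r hs
  refine measurable_of_local (R + r) fun Γ Γ' h => ?_
  obtain ⟨e, he⟩ := ((ballIso_of_mk_eq (mk_out (mk Γ)) _).trans
    (h.trans (ballIso_of_mk_eq (mk_out (mk Γ')).symm _))).exists_sphere_equiv
  rw [sphereMeasure, sphereMeasure, Measure.sum_apply _ hms, Measure.sum_apply _ hms, ← e.tsum_eq]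
  refine tsum_congr fun x => ?_
  rw [Measure.dirac_apply' _ hms, Measure.dirac_apply' _ hms]
  refine Set.indicator_eq_indicator ⟨hs _ _ (he x), hs _ _ (he x).symm⟩ rfl

theorem measurable_sphereMeasure [Finite K] (R : ℕ) :
    Measurable (sphereMeasure R : RootedGraphClass K 1 → _) := by
  refine Measurable.measure_of_isPiSystem rfl isPiSystem_ballClass ?_ ?_
  · rintro _ ⟨r, Δ, rfl⟩
    refine measurable_sphereMeasure_apply R (r := r) fun Γ Γ' h hΓ => ?_
    exact mk_mem_ballClass.2 ((mk_mem_ballClass.1 hΓ).trans h)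
  -- The total mass, that is, the number of vertices on the sphere; the whole space is local for
  -- every radius.
  · exact measurable_sphereMeasure_apply R (r := 0) fun _ _ _ _ => trivial

theorem measurable_massOut [Finite K] {f : RootedGraphClass K 2 → ℝ≥0∞} (hf : Measurable f) :
    Measurable (massOut f) := by
  rw [funext fun g => massOut_eq_tsum hf g]
  exact Measurable.tsum fun R =>
    (Measure.measurable_lintegral hf).comp (measurable_sphereMeasure R)

/-- Exchange the two roots. -/
noncomputable def swapRoots (g : RootedGraphClass K 2) : RootedGraphClass K 2 :=
  mk (g.out.setRoots ![g.out.root 1, g.out.root 0])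

theorem swapRoots_mk (Γ : RootedGraph K 2) :
    swapRoots (mk Γ) = mk (Γ.setRoots ![Γ.root 1, Γ.root 0]) := by
  obtain ⟨φ, hφ⟩ := mk_eq_mk.1 (mk_out (mk Γ))
  refine mk_eq_mk.2 ⟨φ, fun i => ?_, hφ.mark⟩
  fin_cases i
  · exact hφ.root 1
  · exact hφ.root 0

theorem measurable_swapRoots [Finite K] :
    Measurable (swapRoots : RootedGraphClass K 2 → _) := by
  refine measurable_of_ballIso swapRoots_mk fun r => ⟨r, ?_⟩
  rintro Γ Γ' ⟨φ, hroot, hmark⟩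
  have key : ∀ Γ : RootedGraph K 2, (Γ.setRoots ![Γ.root 1, Γ.root 0]).ball r ⊆ Γ.ball r := by
    rintro Γ v ⟨i, hi⟩
    fin_cases i
    · exact ⟨1, hi⟩
    · exact ⟨0, hi⟩
  refine ballIso_of_iso (Γ := Γ.setRoots ![Γ.root 1, Γ.root 0])
    (Γ' := Γ'.setRoots ![Γ'.root 1, Γ'.root 0]) φ (key Γ) (key Γ')
    (fun i hi => ?_) fun v _ => hmark v
  fin_cases i
  · exact hroot 1 hi
  · exact hroot 0 hi

theorem massIn_eq_massOut (f : RootedGraphClass K 2 → ℝ≥0∞) (g : RootedGraphClass K 1) :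
    massIn f g = massOut (f ∘ swapRoots) g := by
  induction g using Quotient.inductionOn with
  | h Γ =>
    refine tsum_congr fun x => congrArg f ?_
    rw [swapRoots_mk]
    rfl

theorem measurable_massIn [Finite K] {f : RootedGraphClass K 2 → ℝ≥0∞} (hf : Measurable f) :
    Measurable (massIn f) := by
  rw [funext fun g => massIn_eq_massOut f g]
  exact measurable_massOut (hf.comp measurable_swapRoots)

theorem lintegral_coloredLaw {f : RootedGraphClass (Fin (3 ^ (d * (d + 1) / 2))) n → ℝ≥0∞}
    (hf : Measurable f) (Γ : RootedGraph K n) :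
    ∫⁻ h, f h ∂coloredLaw d (mk Γ) = ∫⁻ c, f (mk (Γ.setMark c)) ∂coloringLaw Γ.graph d := by
  rw [coloredLaw_mk, lintegral_map hf (measurable_mk_setMark Γ)]

/-- The law of the colors ignores the roots, so one random coloring serves all second roots `x`, and
the average over colors commutes with the sum over `x`. -/
theorem lintegral_massOut_coloredLaw
    {f : RootedGraphClass (Fin (3 ^ (d * (d + 1) / 2))) 2 → ℝ≥0∞} (hf : Measurable f)
    (g : RootedGraphClass K 1) :
    ∫⁻ h, massOut f h ∂coloredLaw d g = massOut (fun g => ∫⁻ h, f h ∂coloredLaw d g) g := by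
  rw [← mk_out g, lintegral_coloredLaw (measurable_massOut hf)]
  have := g.out.countable_V
  have h (x : g.out.V) : Measurable fun c : g.out.V → Fin (3 ^ (d * (d + 1) / 2)) =>
      f (mk ((g.out.setRoots ![g.out.root 0, x]).setMark c)) :=
    hf.comp (measurable_mk_setMark (g.out.setRoots ![g.out.root 0, x]))
  exact (lintegral_tsum fun x => (h x).aemeasurable).trans
    (tsum_congr fun x => (lintegral_coloredLaw hf (g.out.setRoots ![g.out.root 0, x])).symm)

theorem lintegral_massIn_coloredLaw
    {f : RootedGraphClass (Fin (3 ^ (d * (d + 1) / 2))) 2 → ℝ≥0∞} (hf : Measurable f)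
    (g : RootedGraphClass K 1) :
    ∫⁻ h, massIn f h ∂coloredLaw d g = massIn (fun g => ∫⁻ h, f h ∂coloredLaw d g) g := by
  rw [← mk_out g, lintegral_coloredLaw (measurable_massIn hf)]
  have := g.out.countable_V
  have h (x : g.out.V) : Measurable fun c : g.out.V → Fin (3 ^ (d * (d + 1) / 2)) =>
      f (mk ((g.out.setRoots ![x, g.out.root 0]).setMark c)) :=
    hf.comp (measurable_mk_setMark (g.out.setRoots ![x, g.out.root 0]))
  exact (lintegral_tsum fun x => (h x).aemeasurable).trans
    (tsum_congr fun x => (lintegral_coloredLaw hf (g.out.setRoots ![x, g.out.root 0])).symm)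

theorem measurable_forget [Finite K] : Measurable (forget : RootedGraphClass K n → _) :=
  measurable_of_ballIso (T' := fun Γ => Γ.setMark fun _ => ()) (fun _ => rfl) fun r =>
    ⟨r, fun _ _ ⟨φ, hroot, _⟩ => ⟨φ, hroot, fun _ => rfl⟩⟩

theorem map_forget_coloredLaw (g : RootedGraphClass Unit n) :
    (coloredLaw d g).map forget = Measure.dirac g := by
  rw [coloredLaw, Measure.map_map measurable_forget (measurable_mk_setMark _)]
  have : (forget ∘ fun c : g.out.V → Fin (3 ^ (d * (d + 1) / 2)) => mk (g.out.setMark c)) =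
      fun _ => g := funext fun c => mk_out g
  rw [this, Measure.map_const, measure_univ, one_smul]

theorem isProper_mk {Γ : RootedGraph K n} :
    IsProper (mk Γ) ↔ ∀ v w, Γ.graph.Adj v w → Γ.mark v ≠ Γ.mark w := by
  refine ⟨fun h => h Γ rfl, fun h Γ' h' v w hvw => ?_⟩
  obtain ⟨φ, hφ⟩ := mk_eq_mk.1 h'
  rw [← hφ.mark, ← hφ.mark]
  exact h _ _ (φ.map_adj_iff.2 hvw)

/-- Properness within a ball is a local condition, and the balls exhaust the graph. -/
theorem measurableSet_isProper [Finite K] :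
    MeasurableSet {g : RootedGraphClass K (n + 1) | IsProper g} := by
  have h : {g : RootedGraphClass K (n + 1) | IsProper g} = ⋂ r : ℕ,
      {g | ∀ v ∈ g.out.ball r, ∀ w ∈ g.out.ball r, g.out.graph.Adj v w →
        g.out.mark v ≠ g.out.mark w} := by
    ext g
    conv_lhs => rw [← mk_out g]
    simp only [Set.mem_ofPred_eq, isProper_mk, Set.mem_iInter]
    refine ⟨fun h _ v _ w _ => h v w, fun h v w hvw => ?_⟩
    have hv : v ∈ g.out.ball (g.out.graph.dist (g.out.root 0) v) := ⟨0, le_rfl⟩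
    exact h _ v (g.out.ball_subset (Nat.le_succ _) hv) w (g.out.mem_ball_of_adj hv hvw) hvw
  rw [h]
  refine MeasurableSet.iInter fun r => measurableSet_of_local r fun Γ Γ' hΓ hmem v hv w hw hvw => ?_
  obtain ⟨φ, -, hmark⟩ := (ballIso_of_mk_eq (mk_out (mk Γ')) r).trans
    (hΓ.symm.trans (ballIso_of_mk_eq (mk_out (mk Γ)).symm r))
  rw [← hmark ⟨v, hv⟩, ← hmark ⟨w, hw⟩]
  exact hmem _ (φ ⟨v, hv⟩).2 _ (φ ⟨w, hw⟩).2
    (φ.map_adj_iff.2 (show (SimpleGraph.induce _ _).Adj ⟨v, hv⟩ ⟨w, hw⟩ from hvw))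

end RootedGraphClass

theorem SimpleGraph.card_neighborSet_le {V : Type*} {G : SimpleGraph V} {d : ℕ}
    (hd : ∀ v, (G.neighborSet v).encard ≤ d) (v : V) : Nat.card (G.neighborSet v) ≤ d := by
  rw [Nat.card_coe_set_eq]
  exact ENat.toNat_le_of_le_natCast (hd v)

/-! ### Properness, unimodularity and conditional law of the colored graph -/

namespace RootedGraphClass

open RootedGraph

variable {d : ℕ}

theorem coloredLaw_isProper {n : ℕ} {g : RootedGraphClass Unit (n + 1)} (hg : g.DegreeLE d) :
    ∀ᵐ h ∂coloredLaw d g, h.IsProper := by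
  have := g.out.countable_V
  rw [coloredLaw, ae_map_iff (measurable_mk_setMark _).aemeasurable measurableSet_isProper]
  filter_upwards [coloringLaw_proper (SimpleGraph.card_neighborSet_le (hg g.out (mk_out g)))]
    with c hc
  exact isProper_mk.2 hc

/-- Averaging `f` over the colors gives a mass transport on uncolored graphs, to which the
unimodularity of `μ` applies. -/
theorem isUnimodular_bind_coloredLaw {μ : Measure (RootedGraphClass Unit 1)}
    (hμ : IsUnimodular μ) : IsUnimodular (μ.bind (coloredLaw d)) where
  prob := by
    have := hμ.prob
    exact ⟨by simp [Measure.bind_apply MeasurableSet.univ measurable_coloredLaw.aemeasurable]⟩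
  massTransport f hf := by
    rw [Measure.lintegral_bind measurable_coloredLaw.aemeasurable
        (measurable_massOut hf).aemeasurable,
      Measure.lintegral_bind measurable_coloredLaw.aemeasurable (measurable_massIn hf).aemeasurable]
    simp only [lintegral_massOut_coloredLaw hf, lintegral_massIn_coloredLaw hf]
    exact hμ.massTransport _ ((Measure.measurable_lintegral hf).comp measurable_coloredLaw)

theorem map_forget_bind_coloredLaw (μ : Measure (RootedGraphClass Unit 1)) :
    (μ.bind (coloredLaw d)).map forget = μ := by
  ext s hs
  rw [Measure.map_apply measurable_forget hs, Measure.bind_apply (measurable_forget hs)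
    measurable_coloredLaw.aemeasurable]
  simp only [← Measure.map_apply measurable_forget hs, map_forget_coloredLaw,
    Measure.dirac_apply' _ hs]
  exact lintegral_indicator_one hs

theorem isConditionalLaw_bind_coloredLaw (μ : Measure (RootedGraphClass Unit 1)) :
    IsConditionalLaw μ (μ.bind (coloredLaw d)) fun Γ => coloringLaw Γ.graph d where
  prob _ := inferInstance
  equivariant _ _ φ _ := coloringLaw_map_iso φ.symm
  measurable B hB := by
    simp only [← coloredLaw_mk_apply _ hB, mk_out]
    exact (Measure.measurable_coe hB).comp measurable_coloredLaw
  disintegration B hB := by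
    simp only [← coloredLaw_mk_apply _ hB, mk_out]
    exact Measure.bind_apply hB measurable_coloredLaw.aemeasurable

theorem isProper_bind_coloredLaw {μ : Measure (RootedGraphClass Unit 1)}
    (hμ : ∀ᵐ g ∂μ, g.DegreeLE d) : ∀ᵐ h ∂μ.bind (coloredLaw d), h.IsProper := by
  refine (Measure.bind_apply measurableSet_isProper.compl
    measurable_coloredLaw.aemeasurable).trans ?_
  refine (lintegral_congr_ae ?_).trans lintegral_zero
  filter_upwards [hμ] with g hg using coloredLaw_isProper hg

end RootedGraphClass

end RandomColoring

theorem theorem2 (d : ℕ) :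
    -- unimodular random graphs
    (∀ μ : Measure (RootedGraphClass Unit 1), IsUnimodular μ →
      (∀ᵐ g ∂μ, g.DegreeLE d) →
      ∃ ν : Measure (RootedGraphClass (Fin (3 ^ (d * (d + 1) / 2))) 1),
        IsUnimodular ν ∧
        ν.map RootedGraphClass.forget = μ ∧
        (∀ᵐ g ∂ν, g.IsProper) ∧
        ∃ P : (Γ : RootedGraph Unit 1) → Measure (Γ.V → Fin (3 ^ (d * (d + 1) / 2))),
          IsConditionalLaw μ ν P ∧
          ∀ᵐ g ∂μ, ∀ Γ, RootedGraphClass.mk Γ = g → IsDependent Γ.graph 2 (P Γ)) ∧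
    -- unimodular transitive graphs
    (∀ {V : Type*} [Countable V] (G : SimpleGraph V),
      (∀ v, (G.neighborSet v).encard ≤ d) → IsUnimodularTransitive G →
      ∃ P : Measure (V → Fin (3 ^ (d * (d + 1) / 2))),
        IsProbabilityMeasure P ∧
        (∀ᵐ c ∂P, ∀ v w, G.Adj v w → c v ≠ c w) ∧
        (∀ φ : G ≃g G, P.map (fun c v => c (φ v)) = P) ∧
        IsDependent G 2 P) := by
  refine ⟨fun μ hμ hd => ?_, fun {V} _ G hd _ => ?_⟩
  · exact ⟨μ.bind (RootedGraphClass.coloredLaw d),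
      RootedGraphClass.isUnimodular_bind_coloredLaw hμ,
      RootedGraphClass.map_forget_bind_coloredLaw μ,
      RootedGraphClass.isProper_bind_coloredLaw hd, fun Γ => coloringLaw Γ.graph d,
      RootedGraphClass.isConditionalLaw_bind_coloredLaw μ,
      ae_of_all _ fun _ Γ _ => coloringLaw_isDependent Γ.graph d⟩
  · have : ∀ v, Finite (G.neighborSet v) := fun v =>
      (Set.finite_of_encard_le_coe (hd v)).to_subtype
    exact ⟨coloringLaw G d, inferInstance,
      coloringLaw_proper (SimpleGraph.card_neighborSet_le hd), coloringLaw_map_iso,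
      coloringLaw_isDependent G d⟩
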